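/- Let $n\ge 0$ be an integer, let $Y_1,\dots,Y_{n+1}$ be i.i.d. standard exponential random variables (mean $1$), and let $u\in\mathbb{R}^{n+1}$ be a vector with Euclidean norm $1$. Put $Z=\sum_{j=1}^{n+1}u_j(Y_j-1)$. Then $Z$ has a probability density (with respect to Lebesgue measure) that is continuous at $0$, and the density $G_u(0)$ of $Z$ at $0$, that is, the value at $0$ of any version of the density of $Z$ that is continuous at $0$, satisfies $$G_u(0)\ \ge\ \frac1e .$$ Equality $G_u(0)=\frac1e$ holds if $u$ is, up to a permutation of the coordinates and a sign, the vector $(1,0,\dots,0)$, i.e. if $u$ has exactly one nonzero entry. -/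

import Mathlib

open MeasureTheory ProbabilityTheory

/-- `g` is a (Borel, nonnegative, real-valued) version of the probability density of the real
random variable `X` with respect to Lebesgue measure: the law of `X` is `g(t) dt`. -/
def IsDensityOf {Ω : Type*} [MeasurableSpace Ω] (μ : Measure Ω) (X : Ω → ℝ) (g : ℝ → ℝ) : Prop :=
  Measurable g ∧ (∀ t, 0 ≤ g t) ∧ μ.map X = volume.withDensity (fun t => ENNReal.ofReal (g t))

/-- The random variable `u₁ (Y₁ - 1) + ⋯ + uₙ₊₁ (Yₙ₊₁ - 1)`. -/
def centeredSum {n : ℕ} {Ω : Type*} (u : EuclideanSpace ℝ (Fin (n + 1)))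
    (Y : Fin (n + 1) → Ω → ℝ) : Ω → ℝ :=
  fun ω => ∑ j, u j * (Y j ω - 1)

namespace SimplexSlicing

open Filter Topology Set
open Complex (I)

/-! Let `F = laplaceProd u`, so that `t ↦ F (t * I)` is the characteristic function of `Z`. If at
least two coordinates of `u` are nonzero, this function is integrable, and Fourier inversion gives
`2π G_u(0) = ∫ Re F(it) dt`. By conjugation symmetry it suffices to bound the half-line integral
below by `π / e`. If `u` has a single nonzero entry, the density is explicit and its value at `0` is
`1 / e`.

In the upper half-plane `F = exp (logProd u)`, and the half-line is deformed to the steepest descent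
curve `Im logProd u = 0`, a graph `x = descentCurve u y`. There `F` is real and positive, so the
imaginary part of `F dz` is `exp (Re logProd u) dy`. For `u = (1, 0, …, 0)` the curve is `x = 1 - y
cot y` with `0 < y < π`, the integrand is `exp (-descent y)`, and its integral is exactly `π / e`
(`exists_antideriv_exp_neg_descent`).

The core is a comparison at each height `y < π`: the integrand of any unit vector dominates that of
`(1, 0, …, 0)` (`neg_descent_le_sum`). Given `z` on the curve of `u` with `Re z > 0`, some multiple
`v₀ z` with `0 < v₀ ≤ 1` lies on the curve of `(1, 0, …, 0)`. A Lagrange multiplier inequality for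
one coordinate (`exists_multiplier`), applied to `u j / v₀` and summed under the constraints `∑ Im =
0` and `∑ u j ^ 2 = 1`, bounds the exponent below by `-descent (v₀ y) / v₀ ^ 2`. Monotonicity of
`descent y / y ^ 2` then gives `-descent y`.

The deformation is carried out with a primitive of `F`. After replacing `u` by `-u` if necessary, `∑
u j ≥ 0`; the curve then exists at least up to height `π`, and what lies beyond contributes
nonnegatively up to vanishing errors (`exists_im_primitive_ge`). -/

/-! ### One factor and its phase along rays. -/

/-- The logarithm of the Laplace transform of `u (Y - 1)`, `Y` standard exponential. -/
noncomputable def logFactor (u : ℝ) (z : ℂ) : ℂ := -(u * z) - Complex.log (1 - u * z)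

lemma one_sub_mem_slitPlane {z : ℂ} (hz : 0 < z.im) (u : ℝ) : 1 - u * z ∈ Complex.slitPlane := by
  rw [Complex.mem_slitPlane_iff]
  rcases eq_or_ne u 0 with rfl | hu
  · left; simp
  · right; simp [hu, hz.ne']

lemma one_sub_ne_zero {z : ℂ} (hz : 0 < z.im) (u : ℝ) : 1 - u * z ≠ 0 :=
  Complex.slitPlane_ne_zero (one_sub_mem_slitPlane hz u)

@[simp] lemma logFactor_zero_left (z : ℂ) : logFactor 0 z = 0 := by simp [logFactor]

lemma logFactor_mul (u v : ℝ) (z : ℂ) : logFactor (u * v) z = logFactor u (v * z) := by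
  simp [logFactor, mul_assoc]

lemma hasDerivAt_logFactor {u : ℝ} {z : ℂ} (h : 1 - u * z ∈ Complex.slitPlane) :
    HasDerivAt (logFactor u) (u ^ 2 * z / (1 - u * z)) z := by
  have h0 := Complex.slitPlane_ne_zero h
  have h1 : HasDerivAt (fun w : ℂ => (u : ℂ) * w) u z := by
    simpa using (hasDerivAt_id z).const_mul (u : ℂ)
  have h2 := h1.neg.sub ((h1.const_sub 1).clog h)
  refine h2.congr_deriv ?_
  field_simp
  ring

lemma hasDerivAt_logFactor_left {z : ℂ} (hz : 0 < z.im) (v : ℝ) :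
    HasDerivAt (fun t : ℝ => logFactor t z) (v * z ^ 2 / (1 - v * z)) v := by
  have h := one_sub_mem_slitPlane hz v
  have h0 := Complex.slitPlane_ne_zero h
  have h1 : HasDerivAt (fun w : ℂ => w * z) z (v : ℂ) := by
    simpa using (hasDerivAt_id (v : ℂ)).mul_const z
  have h2 := (h1.neg.sub ((h1.const_sub 1).clog h)).comp_ofReal
  refine h2.congr_deriv ?_
  rw [eq_div_iff h0, sub_mul, div_mul_cancel₀ _ h0]
  ring

lemma hasDerivAt_re {f : ℝ → ℂ} {f' : ℂ} {x : ℝ} (h : HasDerivAt f f' x) :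
    HasDerivAt (fun t => (f t).re) f'.re x :=
  Complex.reCLM.hasFDerivAt.comp_hasDerivAt x h

lemma hasDerivAt_im {f : ℝ → ℂ} {f' : ℂ} {x : ℝ} (h : HasDerivAt f f' x) :
    HasDerivAt (fun t => (f t).im) f'.im x :=
  Complex.imCLM.hasFDerivAt.comp_hasDerivAt x h

lemma normSq_one_sub (v : ℝ) (z : ℂ) :
    Complex.normSq (1 - v * z) = 1 - 2 * v * z.re + v ^ 2 * (z.re ^ 2 + z.im ^ 2) := by
  simp [Complex.normSq_apply]; ring

lemma normSq_one_sub_pos {z : ℂ} (hz : 0 < z.im) (v : ℝ) : 0 < Complex.normSq (1 - v * z) :=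
  Complex.normSq_pos.2 (one_sub_ne_zero hz v)

lemma re_deriv_left (v : ℝ) (z : ℂ) :
    (v * z ^ 2 / (1 - v * z)).re = v * (z.re ^ 2 - z.im ^ 2 - v * z.re * (z.re ^ 2 + z.im ^ 2))
      / Complex.normSq (1 - v * z) := by
  rw [Complex.div_re, ← add_div]
  congr 1
  simp [pow_two]; ring

lemma im_deriv_left (v : ℝ) (z : ℂ) :
    (v * z ^ 2 / (1 - v * z)).im = v * z.im * (2 * z.re - v * (z.re ^ 2 + z.im ^ 2))
      / Complex.normSq (1 - v * z) := by
  rw [Complex.div_im, ← sub_div]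
  congr 1
  simp [pow_two]; ring

/-- The sign of the phase along a ray, up to its first positive zero. -/
lemma logFactor_im_pos {z : ℂ} (hz : 0 < z.im) (hx : 0 < z.re) {v₀ : ℝ}
    (h0 : (logFactor v₀ z).im = 0) {v : ℝ} (hv : v ≠ 0) (hlt : v < v₀) :
    0 < (logFactor v z).im := by
  have hd : ∀ v : ℝ, HasDerivAt (fun t : ℝ => (logFactor t z).im)
      (v * z.im * (2 * z.re - v * (z.re ^ 2 + z.im ^ 2)) / Complex.normSq (1 - v * z)) v :=
    fun v => im_deriv_left v z ▸ hasDerivAt_im (hasDerivAt_logFactor_left hz v)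
  have hc : Continuous fun t : ℝ => (logFactor t z).im :=
    continuous_iff_continuousAt.2 fun v => (hd v).continuousAt
  have hr : 0 < z.re ^ 2 + z.im ^ 2 := by positivity
  -- The phase in `t` is stationary only at `0` and at `m`: it falls to `0`, rises up to `m` and
  -- falls afterwards, so `v₀` is its last zero.
  set m := 2 * z.re / (z.re ^ 2 + z.im ^ 2) with hm
  have hm0 : 0 < m := by positivity
  have hmr : m * (z.re ^ 2 + z.im ^ 2) = 2 * z.re := by rw [hm]; field_simp
  have hneg : StrictAntiOn (fun t : ℝ => (logFactor t z).im) (Iic 0) := by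
    refine strictAntiOn_of_deriv_neg (convex_Iic 0) hc.continuousOn fun t ht => ?_
    rw [interior_Iic] at ht
    have ht : t < 0 := ht
    rw [(hd t).deriv]
    refine div_neg_of_neg_of_pos ?_ (normSq_one_sub_pos hz t)
    refine mul_neg_of_neg_of_pos (mul_neg_of_neg_of_pos ht hz) ?_
    nlinarith
  have hinc : StrictMonoOn (fun t : ℝ => (logFactor t z).im) (Icc 0 m) := by
    refine strictMonoOn_of_deriv_pos (convex_Icc 0 m) hc.continuousOn fun t ht => ?_
    rw [interior_Icc] at ht
    rw [(hd t).deriv]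
    refine div_pos (mul_pos (mul_pos ht.1 hz) ?_) (normSq_one_sub_pos hz t)
    nlinarith [ht.2]
  have hdec : StrictAntiOn (fun t : ℝ => (logFactor t z).im) (Ici m) := by
    refine strictAntiOn_of_deriv_neg (convex_Ici m) hc.continuousOn fun t ht => ?_
    rw [interior_Ici] at ht
    have ht : m < t := ht
    rw [(hd t).deriv]
    refine div_neg_of_neg_of_pos ?_ (normSq_one_sub_pos hz t)
    refine mul_neg_of_pos_of_neg (mul_pos (hm0.trans ht) hz) ?_
    nlinarith
  rcases lt_or_gt_of_ne hv with h | h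
  · simpa using hneg h.le (le_refl (0 : ℝ)) h
  · rcases le_or_gt v m with h' | h'
    · simpa using hinc ⟨le_rfl, hm0.le⟩ ⟨h.le, h'⟩ h
    · simpa [h0] using hdec h'.le (h'.trans hlt).le hlt

/-- Every ray in the open first quadrant meets the steepest descent curve of the exponential
distribution. -/
lemma exists_logFactor_im_eq_zero {z : ℂ} (hz : 0 < z.im) (hx : 0 < z.re) :
    ∃ v₀ : ℝ, 0 < v₀ ∧ v₀ * z.im < Real.pi ∧ (logFactor v₀ z).im = 0 ∧
      (v₀ * z : ℂ) = (1 - v₀ * z.im * Real.cos (v₀ * z.im) / Real.sin (v₀ * z.im) : ℝ)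
        + (v₀ * z.im : ℝ) * I := by
  have hd : ∀ v : ℝ, HasDerivAt (fun t : ℝ => (logFactor t z).im)
      (v * z.im * (2 * z.re - v * (z.re ^ 2 + z.im ^ 2)) / Complex.normSq (1 - v * z)) v :=
    fun v => im_deriv_left v z ▸ hasDerivAt_im (hasDerivAt_logFactor_left hz v)
  have hc : Continuous fun t : ℝ => (logFactor t z).im :=
    continuous_iff_continuousAt.2 fun v => (hd v).continuousAt
  have hr : 0 < z.re ^ 2 + z.im ^ 2 := by positivity
  set m := 2 * z.re / (z.re ^ 2 + z.im ^ 2) with hm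
  have hm0 : 0 < m := by positivity
  have hmr : m * (z.re ^ 2 + z.im ^ 2) = 2 * z.re := by rw [hm]; field_simp
  have hinc : StrictMonoOn (fun t : ℝ => (logFactor t z).im) (Icc 0 m) := by
    refine strictMonoOn_of_deriv_pos (convex_Icc 0 m) hc.continuousOn fun t ht => ?_
    rw [interior_Icc] at ht
    rw [(hd t).deriv]
    refine div_pos (mul_pos (mul_pos ht.1 hz) ?_) (normSq_one_sub_pos hz t)
    nlinarith [ht.2]
  have him : ∀ v : ℝ, (logFactor v z).im = -(v * z.im) - (1 - v * z : ℂ).arg := by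
    intro v; simp [logFactor, Complex.log_im]
  have hπ := Real.pi_pos
  have hargneg : ∀ v : ℝ, 0 < v → (1 - v * z : ℂ).arg < 0 := by
    intro v hv
    rw [Complex.arg_neg_iff]; simp; positivity
  -- At `v = π / z.im` the phase is `-π - arg`, negative because `arg > -π`; at `m` it is positive.
  -- The zero lies between, whichever of the two is larger.
  have hb : (logFactor (Real.pi / z.im) z).im < 0 := by
    rw [him]
    have h1 := Complex.neg_pi_lt_arg (1 - (Real.pi / z.im : ℝ) * z)
    have h2 : Real.pi / z.im * z.im = Real.pi := by field_simp
    rw [h2]; linarith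
  have hmpi : 0 < (logFactor m z).im := by
    simpa using hinc ⟨le_rfl, hm0.le⟩ ⟨hm0.le, le_rfl⟩ hm0
  obtain ⟨v₀, hv₀, h0⟩ : ∃ v₀, v₀ ∈ uIcc m (Real.pi / z.im) ∧ (logFactor v₀ z).im = 0 := by
    have := intermediate_value_uIcc (hc.continuousOn (s := uIcc m (Real.pi / z.im)))
    obtain ⟨v, hv, h⟩ := this (show (0 : ℝ) ∈ _ from mem_uIcc.2 (Or.inr ⟨hb.le, hmpi.le⟩))
    exact ⟨v, hv, h⟩
  have hpos : 0 < v₀ := lt_of_lt_of_le (lt_min hm0 (by positivity)) hv₀.1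
  -- Zero phase fixes the argument of `1 - v₀ z`; with its known imaginary part, this determines the
  -- point in terms of the height alone.
  have harg : (1 - v₀ * z : ℂ).arg = -(v₀ * z.im) := by
    have := him v₀; linarith
  have hlt : v₀ * z.im < Real.pi := by
    have := Complex.neg_pi_lt_arg (1 - v₀ * z); linarith
  refine ⟨v₀, hpos, hlt, h0, ?_⟩
  set y := v₀ * z.im with hy
  have hy0 : 0 < y := by positivity
  have hs : 0 < Real.sin y := Real.sin_pos_of_pos_of_lt_pi hy0 hlt
  have hpol := Complex.norm_mul_exp_arg_mul_I (1 - v₀ * z)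
  rw [harg] at hpol
  set ρ := ‖(1 - v₀ * z : ℂ)‖
  have hre := congrArg Complex.re hpol
  have hi := congrArg Complex.im hpol
  simp [Complex.exp_re, Complex.exp_im] at hre hi
  have hρ : ρ = y / Real.sin y := by field_simp; linarith
  apply Complex.ext
  · simp
    rw [hρ] at hre
    have : y * Real.cos y / Real.sin y = y / Real.sin y * Real.cos y := by ring
    simp only [← Complex.ofReal_mul, ← Complex.ofReal_cos, ← Complex.ofReal_sin, ← Complex.ofReal_div, Complex.ofReal_re]
    rw [this]; linarith
  · simp
    simp only [← Complex.ofReal_mul, ← Complex.ofReal_cos, ← Complex.ofReal_sin, ← Complex.ofReal_div, Complex.ofReal_im, ← hy]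
    simp

/-! ### The exponent along the curve of the exponential distribution. -/

/-- The steepest descent exponent of the exponential distribution at height `y`:
`1 - y cot y + log (y / sin y)` for `0 < y < π`. -/
noncomputable def descent (y : ℝ) : ℝ := 1 - Real.cos y / Real.sinc y - Real.log (Real.sinc y)

lemma sinc_pos {y : ℝ} (h0 : 0 ≤ y) (h : y < Real.pi) : 0 < Real.sinc y := by
  rcases h0.eq_or_lt with rfl | h0
  · simp
  · rw [Real.sinc_of_ne_zero h0.ne']
    exact div_pos (Real.sin_pos_of_pos_of_lt_pi h0 h) h0

lemma descent_zero : descent 0 = 0 := by simp [descent]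

lemma descent_eq {y : ℝ} (h0 : 0 < y) (h : y < Real.pi) :
    descent y = 1 - y * Real.cos y / Real.sin y + Real.log (y / Real.sin y) := by
  have hs := Real.sin_pos_of_pos_of_lt_pi h0 h
  rw [descent, Real.sinc_of_ne_zero h0.ne', ← inv_div y, Real.log_inv]
  field_simp
  ring

lemma continuousOn_descent : ContinuousOn descent (Ico 0 Real.pi) := by
  have hs : ∀ y ∈ Ico 0 Real.pi, Real.sinc y ≠ 0 := fun y hy => (sinc_pos hy.1 hy.2).ne'
  unfold descent
  refine ContinuousOn.sub (ContinuousOn.sub continuousOn_const ?_) ?_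
  · exact Real.continuous_cos.continuousOn.div Real.continuous_sinc.continuousOn hs
  · exact Real.continuous_sinc.continuousOn.log hs

lemma hasDerivAt_descent {y : ℝ} (h0 : 0 < y) (h : y < Real.pi) :
    HasDerivAt descent (((1 - y * Real.cos y / Real.sin y) ^ 2 + y ^ 2) / y) y := by
  have hs := Real.sin_pos_of_pos_of_lt_pi h0 h
  have h1 : HasDerivAt (fun y => 1 - y * Real.cos y / Real.sin y + Real.log (y / Real.sin y))
      (((1 - y * Real.cos y / Real.sin y) ^ 2 + y ^ 2) / y) y := by
    have a := ((hasDerivAt_id y).mul (Real.hasDerivAt_cos y)).div (Real.hasDerivAt_sin y) hs.ne'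
    have b := ((hasDerivAt_id y).div (Real.hasDerivAt_sin y) hs.ne').log
      (div_pos h0 hs).ne'
    refine ((a.const_sub 1).add b).congr_deriv ?_
    have hc := Real.sin_sq_add_cos_sq y
    simp only [id, Pi.mul_apply, Pi.div_apply]
    field_simp
    ring
  refine h1.congr_of_eventuallyEq ?_
  filter_upwards [isOpen_Ioo.mem_nhds (⟨h0, h⟩ : y ∈ Ioo 0 Real.pi)] with t ht
  exact descent_eq ht.1 ht.2

/-- The difference vanishes at `0` and has derivative `2 (1 - y cot y) ^ 2 / y`. This settles the
comparison for points on the imaginary axis. -/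
lemma sq_le_two_mul_descent {y : ℝ} (h0 : 0 ≤ y) (h : y < Real.pi) : y ^ 2 ≤ 2 * descent y := by
  have hm : MonotoneOn (fun t => 2 * descent t - t ^ 2) (Ico 0 Real.pi) := by
    refine monotoneOn_of_hasDerivWithinAt_nonneg (convex_Ico 0 Real.pi)
      ((continuousOn_descent.const_smul (2 : ℝ)).sub (by fun_prop))
      (f' := fun t => 2 * (((1 - t * Real.cos t / Real.sin t) ^ 2 + t ^ 2) / t) - 2 * t) ?_ ?_
    · intro t ht
      rw [interior_Ico] at ht
      refine HasDerivAt.hasDerivWithinAt ?_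
      refine (((hasDerivAt_descent ht.1 ht.2).const_mul 2).sub (hasDerivAt_pow 2 t)).congr_deriv ?_
      simp
    · intro t ht
      rw [interior_Ico] at ht
      have := ht.1
      have e : 2 * (((1 - t * Real.cos t / Real.sin t) ^ 2 + t ^ 2) / t) - 2 * t
        = 2 * (1 - t * Real.cos t / Real.sin t) ^ 2 / t := by field_simp; ring
      rw [e]; positivity
  have := hm ⟨le_rfl, Real.pi_pos⟩ ⟨h0, h⟩ h0
  simp [descent_zero] at this
  linarith

lemma polar_identity {y : ℝ} (h0 : 0 < y) (h : y < Real.pi) :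
    (y * Real.cos y / Real.sin y) ^ 2 + y ^ 2 = (y / Real.sin y) ^ 2 := by
  have hs := Real.sin_pos_of_pos_of_lt_pi h0 h
  have hc := Real.sin_sq_add_cos_sq y
  field_simp
  linarith

lemma one_lt_div_sin {y : ℝ} (h0 : 0 < y) (h : y < Real.pi) : 1 < y / Real.sin y := by
  rw [one_lt_div (Real.sin_pos_of_pos_of_lt_pi h0 h)]
  exact Real.sin_lt h0

/-- With `q = (y / sin y) ^ 2`, the numerator of the derivative reduces by `polar_identity` to `q -
1 - log q ≥ 0`. -/
lemma descent_div_sq_monotoneOn : MonotoneOn (fun y => descent y / y ^ 2) (Ioo 0 Real.pi) := by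
  have hd : ∀ t ∈ Ioo 0 Real.pi, HasDerivAt (fun y => descent y / y ^ 2)
      ((((1 - t * Real.cos t / Real.sin t) ^ 2 + t ^ 2) - 2 * descent t) / t ^ 3) t := by
    intro t ht
    have := ht.1
    refine ((hasDerivAt_descent ht.1 ht.2).div (hasDerivAt_pow 2 t) (by positivity)).congr_deriv ?_
    field_simp
    norm_num
    ring
  refine monotoneOn_of_hasDerivWithinAt_nonneg (convex_Ioo 0 Real.pi)
    (fun t ht => (hd t ht).continuousAt.continuousWithinAt)
    (fun t ht => (hd t (interior_subset ht)).hasDerivWithinAt) ?_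
  intro t ht
  rw [interior_Ioo] at ht
  have ht0 := ht.1
  refine div_nonneg ?_ (by positivity)
  rw [descent_eq ht.1 ht.2]
  have hp := polar_identity ht.1 ht.2
  have hq := one_lt_div_sin ht.1 ht.2
  have hl := Real.log_le_sub_one_of_pos (show 0 < (t / Real.sin t) ^ 2 by positivity)
  rw [Real.log_pow] at hl
  push_cast at hl
  nlinarith

/-! ### The multiplier inequality and the comparison at a fixed height. -/

/-- The sign of the derivative makes `K` fall, rise, fall and rise, with breaks at `0`, `v₁`, `1`;
the two minima are both zero. -/
lemma nonneg_of_hasDerivAt_cubic {K N : ℝ → ℝ} {A v₁ : ℝ} (hA : 0 ≤ A) (hv₁0 : 0 ≤ v₁)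
    (hv₁1 : v₁ ≤ 1) (hN : ∀ v, 0 < N v)
    (hK : ∀ v, HasDerivAt K (v * (A * (v - 1) * (v - v₁)) / N v) v)
    (hK0 : K 0 = 0) (hK1 : K 1 = 0) (v : ℝ) : 0 ≤ K v := by
  have hKc : Continuous K := continuous_iff_continuousAt.2 fun v => (hK v).continuousAt
  rcases le_total v 0 with hv | hv
  · have : AntitoneOn K (Iic 0) := by
      refine antitoneOn_of_deriv_nonpos (convex_Iic 0) hKc.continuousOn
        (fun t _ => (hK t).differentiableAt.differentiableWithinAt) fun t ht => ?_
      rw [interior_Iic] at ht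
      have ht : t < 0 := ht
      rw [(hK t).deriv]
      refine div_nonpos_of_nonpos_of_nonneg (mul_nonpos_of_nonpos_of_nonneg ht.le ?_)
        (hN t).le
      rw [mul_assoc]
      exact mul_nonneg hA (mul_nonneg_of_nonpos_of_nonpos (by linarith) (by linarith))
    rw [← hK0]; exact this hv (le_refl (0 : ℝ)) hv
  rcases le_total v v₁ with hv' | hv'
  · have : MonotoneOn K (Icc 0 v₁) := by
      refine monotoneOn_of_deriv_nonneg (convex_Icc 0 v₁) hKc.continuousOn
        (fun t _ => (hK t).differentiableAt.differentiableWithinAt) fun t ht => ?_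
      rw [interior_Icc] at ht
      rw [(hK t).deriv]
      refine div_nonneg (mul_nonneg ht.1.le ?_) (hN t).le
      rw [mul_assoc]
      exact mul_nonneg hA (mul_nonneg_of_nonpos_of_nonpos (by linarith [ht.2])
        (by linarith [ht.2]))
    rw [← hK0]; exact this ⟨le_rfl, hv₁0⟩ ⟨hv, hv'⟩ hv
  rcases le_total v 1 with hv'' | hv''
  · have : AntitoneOn K (Icc v₁ 1) := by
      refine antitoneOn_of_deriv_nonpos (convex_Icc v₁ 1) hKc.continuousOn
        (fun t _ => (hK t).differentiableAt.differentiableWithinAt) fun t ht => ?_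
      rw [interior_Icc] at ht
      rw [(hK t).deriv]
      refine div_nonpos_of_nonpos_of_nonneg
        (mul_nonpos_of_nonneg_of_nonpos (hv₁0.trans ht.1.le) ?_) (hN t).le
      rw [mul_assoc]
      exact mul_nonpos_of_nonneg_of_nonpos hA
        (mul_nonpos_of_nonpos_of_nonneg (by linarith [ht.2]) (by linarith [ht.1]))
    rw [← hK1]; exact this ⟨hv', hv''⟩ ⟨hv₁1, le_rfl⟩ hv''
  · have : MonotoneOn K (Ici 1) := by
      refine monotoneOn_of_deriv_nonneg (convex_Ici 1) hKc.continuousOn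
        (fun t _ => (hK t).differentiableAt.differentiableWithinAt) fun t ht => ?_
      rw [interior_Ici] at ht
      have ht : 1 < t := ht
      rw [(hK t).deriv]
      refine div_nonneg (mul_nonneg (by linarith) ?_) (hN t).le
      rw [mul_assoc]
      exact mul_nonneg hA (mul_nonneg (by linarith) (by linarith))
    rw [← hK1]; exact this (le_refl (1 : ℝ)) hv'' hv''

lemma logFactor_one_eq_neg_descent {y : ℝ} (h0 : 0 < y) (h : y < Real.pi) :
    logFactor 1 ((1 - y * Real.cos y / Real.sin y : ℝ) + y * I) = (-descent y : ℝ) := by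
  have hs := Real.sin_pos_of_pos_of_lt_pi h0 h
  have hρ : 0 < y / Real.sin y := div_pos h0 hs
  have h1z : (1 - ((1 : ℝ) : ℂ) * ((1 - y * Real.cos y / Real.sin y : ℝ) + y * I))
      = ((y / Real.sin y : ℝ) : ℂ) * Complex.exp ((-y : ℝ) * I) := by
    apply Complex.ext
    · rw [Complex.re_ofReal_mul, Complex.exp_ofReal_mul_I_re, Real.cos_neg]
      simp only [Complex.sub_re, Complex.one_re, Complex.re_ofReal_mul, Complex.add_re,
        Complex.ofReal_re, Complex.I_re]
      ring
    · rw [Complex.im_ofReal_mul, Complex.exp_ofReal_mul_I_im, Real.sin_neg]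
      simp only [Complex.sub_im, Complex.one_im, Complex.im_ofReal_mul, Complex.add_im,
        Complex.ofReal_im, Complex.I_im]
      field_simp
      ring
  rw [logFactor, h1z, Complex.log_ofReal_mul hρ (Complex.exp_ne_zero _), Complex.log_exp,
    descent_eq h0 h]
  · push_cast; ring
  · simp; linarith
  · simp; linarith [Real.pi_pos]

/-- The Lagrangian of minimising `∑ Re` under `∑ Im = 0` and `∑ v ^ 2 = 1` is nonnegative in each
coordinate, with equality at `v = 0` and `v = 1`. Its derivative is `v` times a quadratic over a
positive denominator, as `nonneg_of_hasDerivAt_cubic` requires. -/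
lemma exists_multiplier {y : ℝ} (h0 : 0 < y) (h : y < Real.pi) :
    ∃ l : ℝ, ∀ v : ℝ, 0 ≤ (logFactor v ((1 - y * Real.cos y / Real.sin y : ℝ) + y * I)).re
      + l * (logFactor v ((1 - y * Real.cos y / Real.sin y : ℝ) + y * I)).im
      + descent y * v ^ 2 := by
  have hs := Real.sin_pos_of_pos_of_lt_pi h0 h
  have hρ1 := one_lt_div_sin h0 h
  have hpol := polar_identity h0 h
  have hsq := sq_le_two_mul_descent h0.le h
  have hdesc := descent_eq h0 h
  set c := y * Real.cos y / Real.sin y with hc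
  set ρ := y / Real.sin y with hρ
  set x := 1 - c with hxc
  set s := descent y with hs_def
  set z : ℂ := (x : ℝ) + y * I with hzdef
  have hzre : z.re = x := by simp [hzdef]
  have hzim : z.im = y := by simp [hzdef]
  have hz : 0 < z.im := hzim ▸ h0
  set q := ρ ^ 2 with hq
  have hq1 : 1 < q := by rw [hq]; nlinarith
  set L := Real.log q with hL
  have hLρ : L = 2 * Real.log ρ := by rw [hL, hq, Real.log_pow]; norm_num
  have hLle : L ≤ q - 1 := Real.log_le_sub_one_of_pos (by linarith)
  have hLge : q - 1 ≤ q * L := by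
    have := Real.log_le_sub_one_of_pos (show 0 < q⁻¹ by positivity)
    rw [Real.log_inv] at this
    have h2 : q * q⁻¹ = 1 := mul_inv_cancel₀ (by linarith)
    nlinarith
  have hL0 : 0 < L := Real.log_pos hq1
  have hc1 : c < 1 := by
    have : Real.cos y * y < Real.sin y := by
      rcases lt_or_ge y (Real.pi / 2) with h' | h'
      · have h1 := Real.lt_tan h0 h'
        have h2 : 0 < Real.cos y := Real.cos_pos_of_mem_Ioo ⟨by linarith, h'⟩
        rw [Real.tan_eq_sin_div_cos, lt_div_iff₀ h2] at h1
        linarith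
      · have := Real.cos_nonpos_of_pi_div_two_le_of_le h' (by linarith)
        nlinarith
    rw [hc, div_lt_one hs]; linarith
  have hx0 : 0 < x := by rw [hxc]; linarith
  have hse : s = x + L / 2 := by rw [hdesc, hLρ]; ring
  have hr2 : x ^ 2 + y ^ 2 = 2 * x + (q - 1) := by
    have : c = 1 - x := by rw [hxc]; ring
    rw [← hpol, this]; ring
  -- This value of `l` is forced by requiring the derivative of the Lagrangian to vanish at `v = 1`.
  obtain ⟨l, hl⟩ : ∃ l : ℝ, l * y = q * L / (q - 1) - c :=
    ⟨(q * L / (q - 1) - c) / y, by field_simp⟩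
  refine ⟨l, ?_⟩
  have hly : 0 ≤ l * y := by
    rw [hl]
    have : 1 ≤ q * L / (q - 1) := by rw [one_le_div (by linarith)]; exact hLge
    linarith
  set A := 2 * s * (x ^ 2 + y ^ 2) with hA
  set Q0 := x ^ 2 - y ^ 2 + 2 * s + 2 * (l * y) * x with hQ0
  have hs0 : 0 < s := by rw [hse]; positivity
  have hA0 : 0 < A := by positivity
  have hQ0nn : 0 ≤ Q0 := by rw [hQ0]; nlinarith [mul_nonneg hly hx0.le]
  have hlq : (l * y) * (q - 1) = q * L - c * (q - 1) := by
    rw [hl, sub_mul, div_mul_cancel₀ _ (by linarith)]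
  -- The quadratic has leading coefficient `A` and constant term `Q0`; the left side is minus its
  -- linear coefficient. The identity says that `1` is a root, so the other root is `Q0 / A`.
  have hQ1 : (x ^ 2 + y ^ 2) * (x + l * y) + 4 * s * x = A + Q0 := by
    rw [hA, hQ0, hr2]
    have hy2 : y ^ 2 = 2 * x + (q - 1) - x ^ 2 := by linarith
    rw [hy2, hse]
    have hc' : c = 1 - x := by rw [hxc]; ring
    rw [hc'] at hlq
    linear_combination hlq
  -- Multiplied by `q - 1`, the difference is a sum of terms made nonnegative by `log q ≤ q - 1` and
  -- `q > 1`.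
  have hQ0A : Q0 ≤ A := by
    have hkey : (q - 1) * (A - Q0) =
        2 * x * (q * (q - 1) - L) + (q - 1) * (q - 1 - L + L * (q - 1)) := by
      have hy2 : y ^ 2 = 2 * x + (q - 1) - x ^ 2 := by linarith
      have hc' : c = 1 - x := by rw [hxc]; ring
      rw [hc'] at hlq
      rw [hA, hQ0, hr2, hy2, hse]
      linear_combination (-2 * x) * hlq
    have hq0 : 0 ≤ q - 1 := sub_nonneg.2 hq1.le
    have hqL : 0 ≤ q * (q - 1) - L :=
      sub_nonneg.2 (hLle.trans (le_mul_of_one_le_left hq0 hq1.le))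
    have hqL' : 0 ≤ q - 1 - L + L * (q - 1) :=
      add_nonneg (sub_nonneg.2 hLle) (mul_nonneg hL0.le hq0)
    have h1 : 0 ≤ (q - 1) * (A - Q0) := by
      rw [hkey]
      exact add_nonneg (mul_nonneg (mul_nonneg zero_le_two hx0.le) hqL) (mul_nonneg hq0 hqL')
    exact sub_nonneg.1 (nonneg_of_mul_nonneg_right h1 (sub_pos.2 hq1))
  set v₁ := Q0 / A with hv₁
  have hv₁A : v₁ * A = Q0 := by rw [hv₁]; field_simp
  have hv₁0 : 0 ≤ v₁ := by positivity
  have hv₁1 : v₁ ≤ 1 := by rw [hv₁, div_le_one hA0]; exact hQ0A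
  set K : ℝ → ℝ := fun v => (logFactor v z).re + l * (logFactor v z).im + s * v ^ 2 with hK
  have hKd : ∀ v : ℝ, HasDerivAt K (v * (A * (v - 1) * (v - v₁)) / Complex.normSq (1 - v * z)) v := by
    intro v
    have hd := hasDerivAt_logFactor_left hz v
    have h1 := hasDerivAt_re hd
    have h2 := hasDerivAt_im hd
    refine ((h1.add (h2.const_mul l)).add ((hasDerivAt_pow 2 v).const_mul s)).congr_deriv ?_
    have hN := normSq_one_sub_pos hz v
    rw [re_deriv_left, im_deriv_left, eq_div_iff hN.ne', add_mul, add_mul, div_mul_cancel₀ _ hN.ne',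
      mul_assoc l, div_mul_cancel₀ _ hN.ne', normSq_one_sub, hzre, hzim]
    norm_num
    linear_combination (-v ^ 2) * hQ1 + (v ^ 2 - v) * hv₁A
  refine fun v => nonneg_of_hasDerivAt_cubic (K := K) hA0.le hv₁0 hv₁1
    (fun v => normSq_one_sub_pos hz v) hKd (by simp [hK]) ?_ v
  have hf : logFactor 1 z = (-s : ℝ) := logFactor_one_eq_neg_descent h0 h
  simp only [hK, hf, Complex.ofReal_re, Complex.ofReal_im]
  ring

/-- Reflection in the imaginary axis exchanges `u` and `-u`; it transfers results from `Re z ≥ 0` to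
`Re z ≤ 0` and from `x → ∞` to `x → -∞`. -/
lemma logFactor_neg_left {z : ℂ} (hz : 0 < z.im) (u : ℝ) :
    logFactor (-u) (-(starRingEnd ℂ z)) = starRingEnd ℂ (logFactor u z) := by
  have h := Complex.log_conj (1 - u * z) (Complex.mem_slitPlane_iff_arg.1 (one_sub_mem_slitPlane hz u)).1
  simp only [map_sub, map_one, map_mul, Complex.conj_ofReal] at h
  simp [logFactor, ← h]

lemma neg_descent_le_sum_of_re_nonneg {ι : Type*} [Fintype ι] {u : ι → ℝ} (hu : ∑ j, u j ^ 2 = 1)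
    {z : ℂ} (hz : 0 < z.im) (hπ : z.im < Real.pi) (hx : 0 ≤ z.re)
    (h0 : ∑ j, (logFactor (u j) z).im = 0) :
    -descent z.im ≤ ∑ j, (logFactor (u j) z).re := by
  rcases hx.eq_or_lt with hx | hx
  · have h1 : ∀ j, -(u j ^ 2 * z.im ^ 2) / 2 ≤ (logFactor (u j) z).re := by
      intro j
      have e : (logFactor (u j) z).re = - Real.log ‖(1 - u j * z : ℂ)‖ := by
        simp [logFactor, Complex.log_re, ← hx]
      have e2 : ‖(1 - u j * z : ℂ)‖ ^ 2 = 1 + u j ^ 2 * z.im ^ 2 := by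
        rw [← Complex.normSq_eq_norm_sq, normSq_one_sub, ← hx]; ring
      have e3 := Real.log_le_sub_one_of_pos (show 0 < ‖(1 - u j * z : ℂ)‖ ^ 2 by rw [e2]; positivity)
      rw [Real.log_pow, e2] at e3
      rw [e]; push_cast at e3; linarith
    have h2 := Finset.sum_le_sum fun j (_ : j ∈ Finset.univ) => h1 j
    rw [← Finset.sum_div, Finset.sum_neg_distrib, ← Finset.sum_mul, hu] at h2
    have := sq_le_two_mul_descent hz.le hπ
    linarith
  obtain ⟨v₀, hv₀, hlt, hv0, hcont⟩ := exists_logFactor_im_eq_zero hz hx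
  -- If `v₀ > 1`, every nonzero coordinate lies below `v₀` and has positive phase, so the phases
  -- cannot sum to zero.
  have hv1 : v₀ ≤ 1 := by
    by_contra! hgt
    have hle : ∀ j, u j ≤ 1 := by
      intro j
      have : u j ^ 2 ≤ 1 := hu ▸ Finset.single_le_sum (f := fun j => u j ^ 2) (fun i _ => sq_nonneg _)
        (Finset.mem_univ j)
      nlinarith
    have hpos : ∀ j, u j ≠ 0 → 0 < (logFactor (u j) z).im := fun j hj =>
      logFactor_im_pos hz hx hv0 hj ((hle j).trans_lt hgt)
    have hnn : ∀ j ∈ Finset.univ, 0 ≤ (logFactor (u j) z).im := by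
      intro j _
      rcases eq_or_ne (u j) 0 with h | h
      · simp [h]
      · exact (hpos j h).le
    have hall := (Finset.sum_eq_zero_iff_of_nonneg hnn).1 h0
    have : ∀ j, u j = 0 := by
      intro j
      by_contra hj
      exact (hpos j hj).ne' (hall j (Finset.mem_univ j))
    simp [this] at hu
  have hy0 : 0 < v₀ * z.im := by positivity
  obtain ⟨l, hl⟩ := exists_multiplier hy0 hlt
  have hle : v₀ * z.im ≤ z.im := by nlinarith
  have hmono := descent_div_sq_monotoneOn ⟨hy0, hlt⟩ ⟨hz, hπ⟩ hle
  -- The multiplier inequality is used at the point `v₀ z` of the exponential's curve, with `v = u j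
  -- / v₀`.
  have key : ∀ j, 0 ≤ (logFactor (u j) z).re + l * (logFactor (u j) z).im
      + descent (v₀ * z.im) / v₀ ^ 2 * u j ^ 2 := by
    intro j
    have := hl (u j / v₀)
    rw [← hcont, ← logFactor_mul, div_mul_cancel₀ _ hv₀.ne', div_pow] at this
    convert this using 2
    ring
  have hsum := Finset.sum_nonneg fun j (_ : j ∈ Finset.univ) => key j
  rw [Finset.sum_add_distrib, Finset.sum_add_distrib, ← Finset.mul_sum, ← Finset.mul_sum, h0, hu]
    at hsum
  simp only [mul_pow] at hmono
  rw [div_le_div_iff₀ (by positivity) (by positivity)] at hmono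
  have : descent (v₀ * z.im) / v₀ ^ 2 ≤ descent z.im := by
    rw [div_le_iff₀ (by positivity)]
    have hz2 : 0 < z.im ^ 2 := by positivity
    nlinarith
  linarith

/-- On the steepest descent curve of any unit vector the integrand dominates that of the vector
`(1, 0, …, 0)` at the same height. -/
lemma neg_descent_le_sum {ι : Type*} [Fintype ι] {u : ι → ℝ} (hu : ∑ j, u j ^ 2 = 1)
    {z : ℂ} (hz : 0 < z.im) (hπ : z.im < Real.pi) (h0 : ∑ j, (logFactor (u j) z).im = 0) :
    -descent z.im ≤ ∑ j, (logFactor (u j) z).re := by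
  rcases le_total 0 z.re with hx | hx
  · exact neg_descent_le_sum_of_re_nonneg hu hz hπ hx h0
  · have := neg_descent_le_sum_of_re_nonneg (u := fun j => -u j) (by simpa using hu)
      (z := -(starRingEnd ℂ z)) (by simpa using hz) (by simpa using hπ) (by simpa using hx)
      (by simpa [logFactor_neg_left hz] using h0)
    simpa [logFactor_neg_left hz] using this

/-! ### The integral of `exp (-descent y)` over `(0, π)`. -/

/-- The entire function with derivative `(exp w - 1) / w`, real on the real axis. -/
lemma exists_primitive_exp_sub_one_div :
    ∃ E : ℂ → ℂ, (∀ w, HasDerivAt E (dslope Complex.exp 0 w) w) ∧ ∀ x : ℝ, (E x).im = 0 := by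
  have hd : Differentiable ℂ (dslope Complex.exp 0) := by
    rw [← differentiableOn_univ, Complex.differentiableOn_dslope univ_mem]
    exact Complex.differentiable_exp.differentiableOn
  obtain ⟨E, hE0, hE⟩ := hd.isExactOn_univ.with_val_at 0 0
  refine ⟨E, fun w => hE w (mem_univ w), fun x => ?_⟩
  have hder : ∀ x : ℝ, HasDerivAt (fun t : ℝ => (E t).im) 0 x := by
    intro x
    refine (hasDerivAt_im (hE (x : ℂ) (mem_univ _)).comp_ofReal).congr_deriv ?_
    rcases eq_or_ne x 0 with rfl | hx
    · simp [dslope_same]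
    · rw [dslope_of_ne _ (by exact_mod_cast hx), slope_def_field, ← Complex.ofReal_exp]
      simp only [sub_zero, Complex.exp_zero]
      rw [show ((Real.exp x : ℂ) - 1) / (x : ℂ) = (((Real.exp x - 1) / x : ℝ) : ℂ) by push_cast; rfl]
      exact Complex.ofReal_im _
  have := is_const_of_deriv_eq_zero (fun x => (hder x).differentiableAt) (fun x => (hder x).deriv) x 0
  simpa [hE0] using this

/-- An antiderivative of `exp (-descent y)`, which evaluates its integral over `(0, π)`. -/
lemma exists_antideriv_exp_neg_descent :
    ∃ A : ℝ → ℝ, ContinuousOn A (Ico 0 Real.pi) ∧ A 0 = 0 ∧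
      (∀ y ∈ Ioo 0 Real.pi, HasDerivAt A (Real.exp (-descent y)) y) ∧
      Tendsto A (𝓝[<] Real.pi) (𝓝 (Real.pi / Real.exp 1)) := by
  obtain ⟨E, hE, hEim⟩ := exists_primitive_exp_sub_one_div
  set a : ℝ → ℝ := fun y => Real.cos y / Real.sinc y with ha
  have hEc : Continuous E := continuous_iff_continuousAt.2 fun w => (hE w).continuousAt
  have hac : ContinuousOn a (Ico 0 Real.pi) :=
    Real.continuous_cos.continuousOn.div Real.continuous_sinc.continuousOn
      fun y hy => (sinc_pos hy.1 hy.2).ne'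
  -- Put `w = y cot y + i y`. Then `dw/dy = w (1 / y - cot y + i)`, so the imaginary part of `(exp w
  -- - 1) / w * dw/dy` is `exp (y cot y) sin y / y - 1`; adding `y` cancels the `-1`.
  refine ⟨fun y => (y + (E (a y + y * I)).im) / Real.exp 1, ?_, ?_, ?_, ?_⟩
  · refine ContinuousOn.div_const (continuousOn_id.add ?_) _
    refine Complex.continuous_im.comp_continuousOn (hEc.comp_continuousOn ?_)
    exact (Complex.continuous_ofReal.comp_continuousOn hac).add (by fun_prop)
  · simp [ha]
    exact_mod_cast hEim 1
  · intro y hy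
    have hs := Real.sin_pos_of_pos_of_lt_pi hy.1 hy.2
    have hy0 := hy.1
    have haeq : a y = y * Real.cos y / Real.sin y := by
      simp only [ha]; rw [Real.sinc_of_ne_zero hy0.ne']; field_simp
    have had : HasDerivAt a (Real.cos y / Real.sin y - y / Real.sin y ^ 2) y := by
      have h1 : HasDerivAt (fun y => y * Real.cos y / Real.sin y)
          (Real.cos y / Real.sin y - y / Real.sin y ^ 2) y := by
        refine (((hasDerivAt_id y).mul (Real.hasDerivAt_cos y)).div (Real.hasDerivAt_sin y) hs.ne').congr_deriv ?_
        have hc := Real.sin_sq_add_cos_sq y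
        simp only [id, Pi.mul_apply]
        field_simp
        linear_combination (- y) * hc
      refine h1.congr_of_eventuallyEq ?_
      filter_upwards [isOpen_Ioo.mem_nhds hy] with t ht
      have := ht.1
      have hst := Real.sin_pos_of_pos_of_lt_pi ht.1 ht.2
      simp only [ha]; rw [Real.sinc_of_ne_zero this.ne']; field_simp
    have hw : HasDerivAt (fun t : ℝ => (a t : ℂ) + t * I)
        ((Real.cos y / Real.sin y - y / Real.sin y ^ 2 : ℝ) + 1 * I) y :=
      had.ofReal_comp.add ((hasDerivAt_id (y : ℂ)).comp_ofReal.mul_const I)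
    set w : ℂ := (a y : ℂ) + y * I with hwdef
    have hwim : w.im = y := by simp [hwdef]
    have hw0 : w ≠ 0 := fun h => by rw [h] at hwim; simp at hwim; exact hy0.ne hwim
    have hEw := (hE w).comp y hw
    have hval : dslope Complex.exp 0 w * ((Real.cos y / Real.sin y - y / Real.sin y ^ 2 : ℝ) + 1 * I)
        = (Complex.exp w - 1) * ((1 / y - Real.cos y / Real.sin y : ℝ) + I) := by
      rw [dslope_of_ne _ hw0, slope_def_field]
      have : ((Real.cos y / Real.sin y - y / Real.sin y ^ 2 : ℝ) + 1 * I : ℂ)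
          = w * ((1 / y - Real.cos y / Real.sin y : ℝ) + I) := by
        have hc := Real.sin_sq_add_cos_sq y
        apply Complex.ext
        · simp only [hwdef, haeq, Complex.add_re, Complex.mul_re, Complex.ofReal_re, Complex.one_re,
            Complex.I_re, Complex.one_im, Complex.I_im, Complex.ofReal_im, Complex.add_im, Complex.mul_im]
          field_simp
          linear_combination (y ^ 2) * hc
        · simp only [hwdef, haeq, Complex.add_re, Complex.mul_re, Complex.ofReal_re, Complex.one_re,
            Complex.I_re, Complex.one_im, Complex.I_im, Complex.ofReal_im, Complex.add_im, Complex.mul_im]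
          field_simp
          ring
      rw [this, sub_zero, Complex.exp_zero]
      field_simp
    have hEim' := hasDerivAt_im (hEw.congr_deriv hval)
    refine (((hasDerivAt_id y).add hEim').div_const (Real.exp 1)).congr_deriv ?_
    have hexp : Real.exp (-descent y) = Real.exp (a y) * (Real.sin y / y) / Real.exp 1 := by
      rw [descent, neg_sub, sub_eq_add_neg, neg_sub, Real.exp_add, Real.exp_log (sinc_pos hy0.le hy.2),
        Real.exp_sub, Real.sinc_of_ne_zero hy0.ne']
      simp only [ha]
      rw [Real.sinc_of_ne_zero hy0.ne']; ring
    rw [hexp]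
    congr 1
    have e1 : (Complex.exp w).re = Real.exp (a y) * Real.cos y := by
      rw [Complex.exp_re, hwim]; simp [hwdef]
    have e2 : (Complex.exp w).im = Real.exp (a y) * Real.sin y := by
      rw [Complex.exp_im, hwim]; simp [hwdef]
    rw [Complex.mul_im, Complex.sub_re, Complex.sub_im, e1, e2]
    simp only [Complex.one_re, Complex.one_im, Complex.add_im, Complex.add_re, Complex.ofReal_re,
      Complex.ofReal_im, Complex.I_re, Complex.I_im]
    field_simp
    ring
  -- Since `E` is real at `a y`, only a vertical segment of length below `π` matters, in a
  -- half-plane where `|E'| ≤ 2 / |a y|`. As `y → π`, `a y → -∞`.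
  · have hbound : ∀ y ∈ Ioo (Real.pi / 2) Real.pi, |(E (a y + y * I)).im| ≤ 2 / (-a y) * Real.pi := by
      intro y hy
      have hπ := Real.pi_pos
      have hy0 : 0 < y := by linarith [hy.1]
      have hay : a y < 0 := div_neg_of_neg_of_pos
        (Real.cos_neg_of_pi_div_two_lt_of_lt hy.1 (by linarith [hy.2])) (sinc_pos hy0.le hy.2)
      have hconv : Convex ℝ {w : ℂ | w.re ≤ a y} := convex_halfSpace_re_le _
      have h := hconv.norm_image_sub_le_of_norm_hasDerivWithin_le (f := E) (C := 2 / (-a y))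
        (fun w _ => (hE w).hasDerivWithinAt) (fun w (hw : w.re ≤ a y) => by
          have hw0 : w ≠ 0 := fun h => by rw [h] at hw; simp at hw; linarith
          rw [dslope_of_ne _ hw0, slope_def_field, norm_div, sub_zero, Complex.exp_zero]
          refine div_le_div₀ (by norm_num) ?_ (by linarith) ?_
          · refine (norm_sub_le _ _).trans ?_
            rw [Complex.norm_exp, norm_one]
            have : Real.exp w.re ≤ 1 := Real.exp_le_one_iff.2 (by linarith)
            linarith
          · have := Complex.abs_re_le_norm w
            rw [abs_of_neg (by linarith)] at this
            linarith) (x := (a y : ℂ)) (y := a y + y * I)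
        (show (a y : ℂ).re ≤ a y by simp) (show (a y + y * I : ℂ).re ≤ a y by simp)
      have h2 : |(E (a y + y * I)).im| ≤ ‖E (a y + y * I) - E (a y)‖ := by
        have := Complex.abs_im_le_norm (E (a y + y * I) - E (a y))
        rwa [Complex.sub_im, hEim, sub_zero] at this
      refine h2.trans (h.trans ?_)
      have h3 : ‖(a y + y * I - a y : ℂ)‖ = y := by simp [abs_of_pos hy0]
      rw [h3]
      exact mul_le_mul_of_nonneg_left hy.2.le (div_nonneg (by norm_num) (by linarith))
    have hat : Tendsto (fun y => -a y) (𝓝[<] Real.pi) atTop := by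
      have h1 : Tendsto (fun y => -Real.cos y) (𝓝[<] Real.pi) (𝓝 1) := by
        have := (Real.continuous_cos.tendsto Real.pi).neg.mono_left (nhdsWithin_le_nhds (s := Iio Real.pi))
        simpa using this
      have h2 : Tendsto (fun y => (Real.sinc y)⁻¹) (𝓝[<] Real.pi) atTop := by
        refine Tendsto.inv_tendsto_nhdsGT_zero (tendsto_nhdsWithin_iff.2 ⟨?_, ?_⟩)
        · have := (Real.continuous_sinc.tendsto Real.pi).mono_left (nhdsWithin_le_nhds (s := Iio Real.pi))
          simpa [Real.sinc_of_ne_zero Real.pi_ne_zero] using this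
        · filter_upwards [Ioo_mem_nhdsLT Real.pi_pos] with y hy using sinc_pos hy.1.le hy.2
      refine (h1.pos_mul_atTop one_pos h2).congr fun y => ?_
      simp only [ha]; ring
    have hz : Tendsto (fun y => (E (a y + y * I)).im) (𝓝[<] Real.pi) (𝓝 0) := by
      refine squeeze_zero_norm' (a := fun y => 2 / (-a y) * Real.pi) ?_ ?_
      · filter_upwards [Ioo_mem_nhdsLT (show Real.pi / 2 < Real.pi by linarith [Real.pi_pos])] with y hy
        exact hbound y hy
      · simpa using (hat.const_div_atTop 2).mul_const Real.pi
    have := ((tendsto_id.mono_left (nhdsWithin_le_nhds (s := Iio Real.pi) (a := Real.pi))).add hz).div_const (Real.exp 1)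
    simpa using this

/-! ### The steepest descent curve of a general unit vector. -/

section Contour

variable {ι : Type*} [Fintype ι] {u : ι → ℝ}

/-- The Laplace transform of `∑ j, u j * (Y j - 1)`, continued meromorphically. -/
noncomputable def laplaceProd (u : ι → ℝ) (z : ℂ) : ℂ :=
  ∏ j, Complex.exp (-(u j * z)) / (1 - u j * z)

/-- A logarithm of `laplaceProd u` on the upper half-plane. -/
noncomputable def logProd (u : ι → ℝ) (z : ℂ) : ℂ := ∑ j, logFactor (u j) z

lemma exp_logProd {z : ℂ} (hz : 0 < z.im) : Complex.exp (logProd u z) = laplaceProd u z := by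
  rw [logProd, laplaceProd, Complex.exp_sum]
  refine Finset.prod_congr rfl fun j _ => ?_
  rw [logFactor, Complex.exp_sub, Complex.exp_log (one_sub_ne_zero hz _)]

lemma hasDerivAt_logProd {z : ℂ} (hz : ∀ j, 1 - u j * z ∈ Complex.slitPlane) :
    HasDerivAt (logProd u) (∑ j, (u j : ℂ) ^ 2 * z / (1 - u j * z)) z :=
  HasDerivAt.fun_sum fun j _ => hasDerivAt_logFactor (hz j)

/-- Each summand has imaginary part `u j ^ 2 * z.im / |1 - u j z| ^ 2`. Hence the phase increases
strictly in `x`, which makes the zero-phase curve a differentiable graph over `y`. -/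
lemma im_deriv_logProd_pos (hu : ∑ j, u j ^ 2 = 1) {z : ℂ} (hz : 0 < z.im) :
    0 < (∑ j, (u j : ℂ) ^ 2 * z / (1 - u j * z)).im := by
  have h : ∀ j, ((u j : ℂ) ^ 2 * z / (1 - u j * z)).im
      = u j ^ 2 * (z.im / Complex.normSq (1 - u j * z)) := by
    intro j
    rw [Complex.div_im, ← sub_div, mul_div_assoc']
    congr 1
    rw [← Complex.ofReal_pow, Complex.re_ofReal_mul, Complex.im_ofReal_mul]
    simp
    ring
  rw [Complex.im_sum, Finset.sum_congr rfl fun j _ => h j]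
  have hpos : ∀ j, 0 < z.im / Complex.normSq (1 - u j * z) :=
    fun j => div_pos hz (normSq_one_sub_pos hz _)
  obtain ⟨j, hj⟩ : ∃ j, u j ≠ 0 := by
    by_contra! h
    simp [h] at hu
  exact Finset.sum_pos' (fun i _ => mul_nonneg (sq_nonneg _) (hpos i).le)
    ⟨j, Finset.mem_univ j, mul_pos (by positivity) (hpos j)⟩

lemma add_mul_I_im (x y : ℝ) : ((x : ℂ) + y * I).im = y := by simp

lemma hasDerivAt_horizontal (x y : ℝ) : HasDerivAt (fun t : ℝ => (t : ℂ) + y * I) 1 x :=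
  ((hasDerivAt_id (x : ℂ)).comp_ofReal).add_const _

lemma hasDerivAt_vertical (x y : ℝ) : HasDerivAt (fun t : ℝ => (x : ℂ) + t * I) I y := by
  simpa using (((hasDerivAt_id (y : ℂ)).comp_ofReal).mul_const I).const_add (x : ℂ)

lemma strictMono_im_logProd (hu : ∑ j, u j ^ 2 = 1) {y : ℝ} (hy : 0 < y) :
    StrictMono fun x : ℝ => (logProd u (x + y * I)).im := by
  have hd : ∀ x : ℝ, HasDerivAt (fun x : ℝ => (logProd u (x + y * I)).im)
      (∑ j, (u j : ℂ) ^ 2 * (x + y * I) / (1 - u j * (x + y * I))).im x := by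
    intro x
    have hz : 0 < ((x : ℂ) + y * I).im := by simpa using hy
    have := (hasDerivAt_logProd fun j => one_sub_mem_slitPlane hz (u j)).comp x
      (hasDerivAt_horizontal x y)
    rw [mul_one] at this
    exact hasDerivAt_im this
  refine strictMono_of_deriv_pos fun x => ?_
  rw [(hd x).deriv]
  exact im_deriv_logProd_pos hu (by simpa using hy)

lemma logFactor_im (u x y : ℝ) :
    (logFactor u (x + y * I)).im = -(u * y) - (1 - u * (x + y * I) : ℂ).arg := by
  simp [logFactor, Complex.log_im]

/-- Dividing `1 - u z` by `x > 0` keeps the argument and gives the limit `-u`. For `u > 0` this is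
on the branch cut, approached from below, so the argument tends to `-π`. -/
lemma tendsto_logFactor_im_atTop (u : ℝ) {y : ℝ} (hy : 0 < y) :
    Tendsto (fun x : ℝ => (logFactor u (x + y * I)).im) atTop
      (𝓝 ((if 0 < u then Real.pi else 0) - u * y)) := by
  simp only [logFactor_im]
  have hlim : Tendsto (fun x : ℝ => ((x⁻¹ : ℝ) : ℂ) * (1 - u * (x + y * I))) atTop
      (𝓝 (-(u : ℂ))) := by
    have h1 : Tendsto (fun x : ℝ => ((x⁻¹ : ℝ) : ℂ)) atTop (𝓝 ((0 : ℝ) : ℂ)) :=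
      (Complex.continuous_ofReal.tendsto 0).comp tendsto_inv_atTop_zero
    have h2 := (h1.mul_const (1 - u * y * I)).sub_const (u : ℂ)
    simp only [Complex.ofReal_zero, zero_mul, zero_sub] at h2
    refine h2.congr' ?_
    filter_upwards [eventually_gt_atTop 0] with x hx
    have : (x : ℂ) ≠ 0 := by exact_mod_cast hx.ne'
    push_cast
    field_simp
    ring
  have harg : ∀ᶠ x : ℝ in atTop, (((x⁻¹ : ℝ) : ℂ) * (1 - u * (x + y * I))).arg
      = (1 - u * (x + y * I) : ℂ).arg := by
    filter_upwards [eventually_gt_atTop 0] with x hx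
    exact Complex.arg_real_mul _ (inv_pos.2 hx)
  rcases lt_trichotomy u 0 with h | h | h
  · rw [if_neg h.not_gt]
    have hc : ContinuousAt Complex.arg (-(u : ℂ)) :=
      Complex.continuousAt_arg (by left; simpa using h)
    have h3 := (hc.tendsto.comp hlim).congr' harg
    rw [← Complex.ofReal_neg, Complex.arg_ofReal_of_nonneg (by linarith)] at h3
    convert! h3.const_sub (-(u * y)) using 2
    ring
  · subst h; simp
  · rw [if_pos h]
    have hc := Complex.tendsto_arg_nhdsWithin_im_neg_of_re_neg_of_im_zero (z := -(u : ℂ))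
      (by simpa using h) (by simp)
    have h4 : Tendsto (fun x : ℝ => ((x⁻¹ : ℝ) : ℂ) * (1 - u * (x + y * I))) atTop
        (𝓝[{z : ℂ | z.im < 0}] (-(u : ℂ))) := by
      refine tendsto_nhdsWithin_iff.2 ⟨hlim, ?_⟩
      filter_upwards [eventually_gt_atTop 0] with x hx
      show (((x⁻¹ : ℝ) : ℂ) * (1 - u * (x + y * I))).im < 0
      rw [Complex.im_ofReal_mul]
      simp
      positivity
    have h3 := (hc.comp h4).congr' harg
    convert! h3.const_sub (-(u * y)) using 2
    ring

lemma tendsto_logFactor_im_atBot (u : ℝ) {y : ℝ} (hy : 0 < y) :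
    Tendsto (fun x : ℝ => (logFactor u (x + y * I)).im) atBot
      (𝓝 (-(if u < 0 then Real.pi else 0) - u * y)) := by
  have h := ((tendsto_logFactor_im_atTop (-u) hy).comp tendsto_neg_atBot_atTop).neg
  convert! h using 2 with x
  · have := logFactor_neg_left (z := x + y * I) (by simpa using hy) u
    have e : -(starRingEnd ℂ) ((x : ℂ) + y * I) = ((-x : ℝ) : ℂ) + y * I := by simp [add_comm]
    rw [e] at this
    simp only [Function.comp, this, Complex.conj_im, neg_neg]
  · simp only [Left.neg_pos_iff]; ring

lemma tendsto_logProd_im_atTop (u : ι → ℝ) {y : ℝ} (hy : 0 < y) :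
    Tendsto (fun x : ℝ => (logProd u (x + y * I)).im) atTop
      (𝓝 ((Finset.univ.filter fun j => 0 < u j).card * Real.pi - y * ∑ j, u j)) := by
  have h := tendsto_finsetSum Finset.univ fun j _ => tendsto_logFactor_im_atTop (u j) hy
  simp only [logProd, Complex.im_sum]
  convert! h using 2
  rw [Finset.sum_sub_distrib, ← Finset.sum_mul, ← Finset.sum_filter, Finset.sum_const, nsmul_eq_mul,
    mul_comm y]

lemma tendsto_logProd_im_atBot (u : ι → ℝ) {y : ℝ} (hy : 0 < y) :
    Tendsto (fun x : ℝ => (logProd u (x + y * I)).im) atBot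
      (𝓝 (-((Finset.univ.filter fun j => u j < 0).card * Real.pi) - y * ∑ j, u j)) := by
  have h := tendsto_finsetSum Finset.univ fun j _ => tendsto_logFactor_im_atBot (u j) hy
  simp only [logProd, Complex.im_sum]
  convert! h using 2
  rw [Finset.sum_sub_distrib, ← Finset.sum_mul, Finset.sum_neg_distrib, ← Finset.sum_filter,
    Finset.sum_const, nsmul_eq_mul, mul_comm y]

lemma exists_neg_of_sum_eq_zero (hu : ∑ j, u j ^ 2 = 1) (h : ∑ j, u j = 0) : ∃ j, u j < 0 := by
  by_contra! hnn
  have := (Finset.sum_eq_zero_iff_of_nonneg fun j _ => hnn j).1 h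
  rw [Finset.sum_congr rfl fun j hj => by rw [this j hj]] at hu
  simp at hu

/-- The abscissa at height `y` of the steepest descent curve of `laplaceProd u`. -/
noncomputable def descentCurve (u : ι → ℝ) (y : ℝ) : ℝ :=
  open Classical in
  if h : ∃ x : ℝ, (logProd u (x + y * I)).im = 0 then h.choose else 0

/-- The steepest descent curve exists at these heights. -/
def IsAdmissible (u : ι → ℝ) (y : ℝ) : Prop :=
  0 < y ∧ y * ∑ j, u j < (Finset.univ.filter fun j => 0 < u j).card * Real.pi

/-- Admissibility says precisely that the phase limit at `+∞` is positive. The limit at `-∞` is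
negative because `∑ u j ≥ 0`; when the sum is zero, some coordinate is negative. -/
lemma im_logProd_descentCurve (hu : ∑ j, u j ^ 2 = 1) (hs : 0 ≤ ∑ j, u j) {y : ℝ}
    (hy : IsAdmissible u y) : (logProd u (descentCurve u y + y * I)).im = 0 := by
  have h : ∃ x : ℝ, (logProd u (x + y * I)).im = 0 := by
    have hc : Continuous fun x : ℝ => (logProd u (x + y * I)).im := by
      refine continuous_iff_continuousAt.2 fun x => ?_
      have hz : 0 < ((x : ℂ) + y * I).im := by simpa using hy.1
      have := (hasDerivAt_logProd fun j => one_sub_mem_slitPlane hz (u j)).comp x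
        (hasDerivAt_horizontal x y)
      exact (hasDerivAt_im this).continuousAt
    have hπ := Real.pi_pos
    obtain ⟨b, hb⟩ := ((tendsto_logProd_im_atTop u hy.1).eventually_const_lt
      (sub_pos.2 hy.2)).exists
    have hneg : -((Finset.univ.filter fun j => u j < 0).card * Real.pi) - y * ∑ j, u j < 0 := by
      rcases hs.eq_or_lt with h | h
      · obtain ⟨j, hj⟩ := exists_neg_of_sum_eq_zero hu h.symm
        have hcard : 0 < (Finset.univ.filter fun j => u j < 0).card :=
          Finset.card_pos.2 ⟨j, by simpa using hj⟩
        rw [← h]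
        have : (0 : ℝ) < (Finset.univ.filter fun j => u j < 0).card := by exact_mod_cast hcard
        nlinarith
      · have := mul_pos hy.1 h
        have : 0 ≤ ((Finset.univ.filter fun j => u j < 0).card : ℝ) * Real.pi := by positivity
        linarith
    obtain ⟨a, ha⟩ := ((tendsto_logProd_im_atBot u hy.1).eventually_lt_const hneg).exists
    exact mem_range_of_exists_le_of_exists_ge hc ⟨a, ha.le⟩ ⟨b, hb.le⟩
  rw [descentCurve, dif_pos h]
  exact h.choose_spec

lemma isOpen_isAdmissible (u : ι → ℝ) : IsOpen {y | IsAdmissible u y} :=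
  (isOpen_lt continuous_const continuous_id).inter
    (isOpen_lt (continuous_id.mul continuous_const) continuous_const)

lemma IsAdmissible.mono (hs : 0 ≤ ∑ j, u j) {y t : ℝ} (hy : IsAdmissible u y) (ht : 0 < t)
    (hty : t ≤ y) : IsAdmissible u t :=
  ⟨ht, (mul_le_mul_of_nonneg_right hty hs).trans_lt hy.2⟩

/-- A level curve of a real function strictly increasing in the first variable, written as a graph
over the second variable, is differentiable. -/
lemma hasDerivAt_of_graph {Φ : ℂ → ℂ} {X : ℝ → ℝ} {A : ℂ} {y₀ : ℝ}
    (hΦ : HasDerivAt Φ A (X y₀ + y₀ * I)) (hA : 0 < A.im)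
    (hmono : ∀ᶠ y : ℝ in 𝓝 y₀, StrictMono fun x : ℝ => (Φ (x + y * I)).im)
    (hX : ∀ᶠ y : ℝ in 𝓝 y₀, (Φ (X y + y * I)).im = 0) :
    HasDerivAt X (-A.re / A.im) y₀ := by
  have hX0 := hX.self_of_nhds
  -- Lines of slope `m` through the point act as barriers: along such a line the level function
  -- changes sign according to whether `m` exceeds `-A.re / A.im`, and monotonicity in `x` places
  -- the graph on the corresponding side.
  have hdir : ∀ m : ℝ, HasDerivAt (fun y : ℝ => (Φ ((X y₀ + m * (y - y₀) : ℝ) + y * I)).im)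
      (A * (m + I)).im y₀ := by
    intro m
    have h1 : HasDerivAt (fun y : ℝ => (((X y₀ + m * (y - y₀) : ℝ) : ℂ) + y * I)) (m + I) y₀ := by
      have a : HasDerivAt (fun y : ℝ => X y₀ + m * (y - y₀)) m y₀ := by
        simpa using (((hasDerivAt_id y₀).sub_const y₀).const_mul m).const_add (X y₀)
      have b : HasDerivAt (fun y : ℝ => (y : ℂ) * I) I y₀ := by
        simpa using ((hasDerivAt_id (y₀ : ℂ)).comp_ofReal).mul_const I
      exact a.ofReal_comp.add b
    have h2 : HasDerivAt Φ A (((X y₀ + m * (y₀ - y₀) : ℝ) : ℂ) + y₀ * I) := by simpa using hΦ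
    exact hasDerivAt_im (h2.comp y₀ h1)
  have hval : ∀ m : ℝ, (A * (m + I)).im = A.im * (m - -A.re / A.im) := by
    intro m
    simp only [Complex.mul_im, Complex.add_re, Complex.add_im, Complex.ofReal_re, Complex.ofReal_im,
      Complex.I_re, Complex.I_im]
    field_simp
    ring
  rw [hasDerivAt_iff_tendsto_slope, tendsto_order]
  have hslope : ∀ m : ℝ, Tendsto (slope (fun y : ℝ => (Φ ((X y₀ + m * (y - y₀) : ℝ) + y * I)).im) y₀)
      (𝓝[≠] y₀) (𝓝 (A.im * (m - -A.re / A.im))) := fun m =>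
    hval m ▸ hasDerivAt_iff_tendsto_slope.1 (hdir m)
  have hbase : ∀ m : ℝ, (Φ ((X y₀ + m * (y₀ - y₀) : ℝ) + y₀ * I)).im = 0 := by
    intro m; simpa using hX0
  constructor
  · intro m hm
    have hneg : A.im * (m - -A.re / A.im) < 0 := mul_neg_of_pos_of_neg hA (by linarith)
    filter_upwards [(hslope m).eventually_lt_const hneg, nhdsWithin_le_nhds hmono,
      nhdsWithin_le_nhds hX, self_mem_nhdsWithin] with y h1 h2 h3 h4
    rw [slope_def_field, hbase, sub_zero] at h1
    rw [slope_def_field]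
    rcases lt_or_gt_of_ne (show y ≠ y₀ from h4) with h | h
    · rw [lt_div_iff_of_neg (by linarith)]
      rw [div_lt_iff_of_neg (by linarith), zero_mul, ← h3] at h1
      have := h2.lt_iff_lt.1 h1
      linarith
    · rw [lt_div_iff₀ (by linarith)]
      rw [div_lt_iff₀ (by linarith), zero_mul, ← h3] at h1
      have := h2.lt_iff_lt.1 h1
      linarith
  · intro m hm
    have hneg : 0 < A.im * (m - -A.re / A.im) := mul_pos hA (by linarith)
    filter_upwards [(hslope m).eventually_const_lt hneg, nhdsWithin_le_nhds hmono,
      nhdsWithin_le_nhds hX, self_mem_nhdsWithin] with y h1 h2 h3 h4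
    rw [slope_def_field, hbase, sub_zero] at h1
    rw [slope_def_field]
    rcases lt_or_gt_of_ne (show y ≠ y₀ from h4) with h | h
    · rw [div_lt_iff_of_neg (by linarith)]
      rw [lt_div_iff_of_neg (by linarith), zero_mul, ← h3] at h1
      have := h2.lt_iff_lt.1 h1
      linarith
    · rw [div_lt_iff₀ (by linarith)]
      rw [lt_div_iff₀ (by linarith), zero_mul, ← h3] at h1
      have := h2.lt_iff_lt.1 h1
      linarith

lemma hasDerivAt_descentCurve (hu : ∑ j, u j ^ 2 = 1) (hs : 0 ≤ ∑ j, u j) {y : ℝ}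
    (hy : IsAdmissible u y) : ∃ m, HasDerivAt (descentCurve u) m y := by
  have hz : 0 < ((descentCurve u y : ℂ) + y * I).im := by simpa using hy.1
  refine ⟨_, hasDerivAt_of_graph (hasDerivAt_logProd fun j => one_sub_mem_slitPlane hz (u j))
    (im_deriv_logProd_pos hu hz) ?_ ?_⟩
  · filter_upwards [lt_mem_nhds hy.1] with t ht using strictMono_im_logProd hu ht
  · filter_upwards [(isOpen_isAdmissible u).mem_nhds hy] with t ht using
      im_logProd_descentCurve hu hs ht

/-- For fixed `|x| < 1`, the phase at `x + i y` is asymptotic to `y x ∑ u j ^ 2 / (1 - u j x)`,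
which has the sign of `x`; the zero of the phase is therefore squeezed to `0`. -/
lemma tendsto_descentCurve_zero (hu : ∑ j, u j ^ 2 = 1) (hs : 0 ≤ ∑ j, u j)
    (hadm : ∀ᶠ y in 𝓝[>] (0 : ℝ), IsAdmissible u y) :
    Tendsto (descentCurve u) (𝓝[>] 0) (𝓝 0) := by
  have hle : ∀ j, |u j| ≤ 1 := by
    intro j
    have : u j ^ 2 ≤ 1 := hu ▸ Finset.single_le_sum (f := fun j => u j ^ 2)
      (fun i _ => sq_nonneg _) (Finset.mem_univ j)
    exact abs_le_one_iff_mul_self_le_one.2 (by nlinarith)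
  have hpos : ∀ x : ℝ, |x| < 1 → ∀ j, 0 < 1 - u j * x := by
    intro x hx j
    have h1 : |u j * x| < 1 := by
      rw [abs_mul]
      exact (mul_le_of_le_one_left (abs_nonneg x) (hle j)).trans_lt hx
    linarith [(abs_lt.1 h1).2]
  have hslope : ∀ x : ℝ, |x| < 1 → Tendsto (fun y : ℝ => y⁻¹ * (logProd u (x + y * I)).im) (𝓝[>] 0)
      (𝓝 (x * ∑ j, u j ^ 2 / (1 - u j * x))) := by
    intro x hx
    have hsl : ∀ j, 1 - (u j : ℂ) * ((x : ℂ) + ((0 : ℝ) : ℂ) * I) ∈ Complex.slitPlane := by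
      intro j
      left
      simpa using hpos x hx j
    have h1 := hasDerivAt_im ((hasDerivAt_logProd hsl).comp 0 (hasDerivAt_vertical x 0))
    have h2 : (logProd u ((x : ℂ) + ((0 : ℝ) : ℂ) * I)).im = 0 := by
      rw [logProd, Complex.im_sum]
      refine Finset.sum_eq_zero fun j _ => ?_
      rw [logFactor_im, mul_zero, neg_zero, zero_sub, neg_eq_zero]
      have : (1 - (u j : ℂ) * ((x : ℂ) + ((0 : ℝ) : ℂ) * I)) = ((1 - u j * x : ℝ) : ℂ) := by simp
      rw [this, Complex.arg_ofReal_of_nonneg (hpos x hx j).le]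
    have h3 := (hasDerivAt_iff_tendsto_slope.1 h1).mono_left (nhdsWithin_mono 0 fun y (hy : 0 < y) => hy.ne')
    have h5 : ∀ j, (u j : ℂ) ^ 2 * ((x : ℂ) + ((0 : ℝ) : ℂ) * I)
        / (1 - (u j : ℂ) * ((x : ℂ) + ((0 : ℝ) : ℂ) * I))
        = ((x * (u j ^ 2 / (1 - u j * x)) : ℝ) : ℂ) := by
      intro j; push_cast; simp; ring
    rw [Finset.sum_congr rfl fun j _ => h5 j, ← Complex.ofReal_sum, ← Finset.mul_sum,
      Complex.im_ofReal_mul, Complex.I_im, mul_one] at h3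
    refine h3.congr fun y => ?_
    simp only [slope_def_field, Function.comp, h2, sub_zero]
    rw [div_eq_inv_mul]
  have hsum : ∀ x : ℝ, |x| < 1 → 0 < ∑ j, u j ^ 2 / (1 - u j * x) := by
    intro x hx
    obtain ⟨j, hj⟩ : ∃ j, u j ≠ 0 := by
      by_contra! h
      simp [h] at hu
    exact Finset.sum_pos' (fun i _ => div_nonneg (sq_nonneg _) (hpos x hx i).le)
      ⟨j, Finset.mem_univ j, div_pos (by positivity) (hpos x hx j)⟩
  rw [tendsto_order]
  constructor
  · intro x hx
    wlog hx1 : -1 < x generalizing x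
    · filter_upwards [this (-1 / 2) (by norm_num) (by norm_num)] with y hy
      linarith
    have hxa : |x| < 1 := abs_lt.2 ⟨hx1, by linarith⟩
    have hneg : x * ∑ j, u j ^ 2 / (1 - u j * x) < 0 := mul_neg_of_neg_of_pos hx (hsum x hxa)
    filter_upwards [(hslope x hxa).eventually_lt_const hneg, hadm, self_mem_nhdsWithin] with y h1 h2 h3
    have h4 : (logProd u (x + y * I)).im < 0 := by
      have := inv_pos.2 (show 0 < y from h3)
      by_contra! hc
      exact absurd (mul_nonneg this.le hc) (not_le.2 h1)
    rw [← im_logProd_descentCurve hu hs h2] at h4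
    exact (strictMono_im_logProd hu h2.1).lt_iff_lt.1 h4
  · intro x hx
    wlog hx1 : x < 1 generalizing x
    · filter_upwards [this (1 / 2) (by norm_num) (by norm_num)] with y hy
      linarith
    have hxa : |x| < 1 := abs_lt.2 ⟨by linarith, hx1⟩
    have hneg : 0 < x * ∑ j, u j ^ 2 / (1 - u j * x) := mul_pos hx (hsum x hxa)
    filter_upwards [(hslope x hxa).eventually_const_lt hneg, hadm, self_mem_nhdsWithin] with y h1 h2 h3
    have h4 : 0 < (logProd u (x + y * I)).im := by
      have := inv_pos.2 (show 0 < y from h3)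
      by_contra! hc
      exact absurd (mul_nonpos_of_nonneg_of_nonpos this.le hc) (not_le.2 h1)
    rw [← im_logProd_descentCurve hu hs h2] at h4
    exact (strictMono_im_logProd hu h2.1).lt_iff_lt.1 h4

/-! ### A primitive of the transform and its growth along the curve. -/

/-- This domain contains the starting point `0` of the contours, avoids the real poles `1 / u j`,
and its convexity provides a primitive. -/
lemma convex_insert_zero_upperHalfPlane : Convex ℝ (insert 0 {z : ℂ | 0 < z.im}) := by
  intro z hz w hw a b ha hb hab
  rcases hz with rfl | hz <;> rcases hw with rfl | hw
  · left; simp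
  · rcases hb.eq_or_lt with rfl | hb
    · left; simp
    · right
      have hw : 0 < w.im := hw
      simpa using mul_pos hb hw
  · rcases ha.eq_or_lt with rfl | ha
    · left; simp
    · right
      have hz : 0 < z.im := hz
      simpa using mul_pos ha hz
  · right
    have hz : 0 < z.im := hz
    have hw : 0 < w.im := hw
    show 0 < (a • z + b • w).im
    rw [Complex.add_im, Complex.smul_im, Complex.smul_im, smul_eq_mul, smul_eq_mul]
    rcases ha.eq_or_lt with rfl | ha
    · rw [zero_add] at hab; subst hab; simpa using hw
    · have := mul_pos ha hz
      have := mul_nonneg hb hw.le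
      linarith

lemma differentiableAt_laplaceProd {z : ℂ} (hz : ∀ j, 1 - u j * z ≠ 0) :
    DifferentiableAt ℂ (laplaceProd u) z := by
  unfold laplaceProd
  refine DifferentiableAt.fun_finsetProd fun j _ => ?_
  exact DifferentiableAt.div (by fun_prop) (by fun_prop) (hz j)

/-- `P` is a primitive of `laplaceProd u` on the upper half-plane with the origin adjoined. -/
def IsLaplacePrimitive (u : ι → ℝ) (P : ℂ → ℂ) : Prop :=
  ∀ z ∈ insert 0 {z : ℂ | 0 < z.im},
    HasDerivWithinAt P (laplaceProd u z) (insert 0 {z : ℂ | 0 < z.im}) z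

lemma exists_isLaplacePrimitive (u : ι → ℝ) : ∃ P, IsLaplacePrimitive u P := by
  refine convex_insert_zero_upperHalfPlane.exists_forall_hasDerivWithinAt fun z hz => ?_
  refine (differentiableAt_laplaceProd fun j => ?_).differentiableWithinAt
  rcases hz with rfl | hz
  · simp
  · exact one_sub_ne_zero hz _

lemma IsLaplacePrimitive.hasDerivAt {P : ℂ → ℂ} (hP : IsLaplacePrimitive u P) {z : ℂ}
    (hz : 0 < z.im) : HasDerivAt P (laplaceProd u z) z := by
  refine (hP z (mem_insert_of_mem _ hz)).hasDerivAt ?_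
  exact mem_of_superset ((isOpen_lt continuous_const Complex.continuous_im).mem_nhds hz)
    (subset_insert _ _)

/-- The imaginary part of the primitive along the steepest descent curve. -/
lemma hasDerivAt_im_primitive_descentCurve (hu : ∑ j, u j ^ 2 = 1) (hs : 0 ≤ ∑ j, u j)
    {P : ℂ → ℂ} (hP : IsLaplacePrimitive u P) {y : ℝ} (hy : IsAdmissible u y) :
    HasDerivAt (fun t : ℝ => (P (descentCurve u t + t * I)).im)
      (Real.exp (logProd u (descentCurve u y + y * I)).re) y := by
  have hz : 0 < ((descentCurve u y : ℂ) + y * I).im := by simpa using hy.1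
  obtain ⟨m, hm⟩ := hasDerivAt_descentCurve hu hs hy
  have hb : HasDerivAt (fun y : ℝ => (y : ℂ) * I) I y := by
    simpa using ((hasDerivAt_id (y : ℂ)).comp_ofReal).mul_const I
  refine (hasDerivAt_im ((hP.hasDerivAt hz).comp y (hm.ofReal_comp.add hb))).congr_deriv ?_
  have him := im_logProd_descentCurve hu hs hy
  have h1 : laplaceProd u (descentCurve u y + y * I)
      = (Real.exp (logProd u (descentCurve u y + y * I)).re : ℂ) := by
    rw [← exp_logProd hz, Complex.ofReal_exp]
    congr 1
    exact Complex.ext (by simp) (by simpa using him)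
  rw [h1, Complex.im_ofReal_mul]
  simp

/-- Below height `π` the imaginary part of the primitive grows at least as fast as the
antiderivative of `exp (-descent y)`, which gains `π / e`; from there to `b` it still increases. -/
lemma le_im_primitive_descentCurve (hu : ∑ j, u j ^ 2 = 1) (hs : 0 ≤ ∑ j, u j)
    {P : ℂ → ℂ} (hP : IsLaplacePrimitive u P) {b : ℝ} (hb : IsAdmissible u b) (hπb : Real.pi ≤ b) :
    (P 0).im + Real.pi / Real.exp 1 ≤ (P (descentCurve u b + b * I)).im := by
  obtain ⟨A, hAc, hA0, hAd, hAlim⟩ := exists_antideriv_exp_neg_descent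
  set D : ℝ → ℝ := fun t => (P (descentCurve u t + t * I)).im with hD
  have hπ := Real.pi_pos
  have hadm : ∀ y ∈ Ioo 0 Real.pi, IsAdmissible u y := fun y hy =>
    hb.mono hs hy.1 (hy.2.le.trans hπb)
  have hmono1 : MonotoneOn (fun y => D y - A y) (Ioo 0 Real.pi) := by
    have hder : ∀ y ∈ Ioo 0 Real.pi, HasDerivAt (fun y => D y - A y)
        (Real.exp (logProd u (descentCurve u y + y * I)).re - Real.exp (-descent y)) y :=
      fun y hy => (hasDerivAt_im_primitive_descentCurve hu hs hP (hadm y hy)).sub (hAd y hy)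
    refine monotoneOn_of_hasDerivWithinAt_nonneg (convex_Ioo 0 Real.pi)
      (fun y hy => (hder y hy).continuousAt.continuousWithinAt)
      (fun y hy => (hder y (interior_subset hy)).hasDerivWithinAt) fun y hy => ?_
    have hy := interior_subset hy
    have h := neg_descent_le_sum hu (z := descentCurve u y + y * I) (by simpa using hy.1)
      (by simpa using hy.2)
      (by simpa [logProd, Complex.im_sum] using im_logProd_descentCurve hu hs (hadm y hy))
    rw [add_mul_I_im] at h
    rw [sub_nonneg, Real.exp_le_exp, logProd, Complex.re_sum]
    exact h
  have hmono2 : MonotoneOn D (Ioc 0 b) := by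
    have hder : ∀ y ∈ Ioc 0 b, HasDerivAt D (Real.exp (logProd u (descentCurve u y + y * I)).re) y :=
      fun y hy => hasDerivAt_im_primitive_descentCurve hu hs hP (hb.mono hs hy.1 hy.2)
    exact monotoneOn_of_hasDerivWithinAt_nonneg (convex_Ioc 0 b)
      (fun y hy => (hder y hy).continuousAt.continuousWithinAt)
      (fun y hy => (hder y (interior_subset hy)).hasDerivWithinAt) fun y _ => (Real.exp_pos _).le
  have hzero : Tendsto (fun y => D y - A y) (𝓝[>] 0) (𝓝 ((P 0).im - 0)) := by
    refine Tendsto.sub ?_ ?_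
    · refine (Complex.continuous_im.tendsto _).comp ?_
      refine (hP 0 (mem_insert _ _)).continuousWithinAt.tendsto.comp
        (tendsto_nhdsWithin_iff.2 ⟨?_, ?_⟩)
      · have h1 := tendsto_descentCurve_zero hu hs
          (mem_of_superset (Ioo_mem_nhdsGT hπ) hadm)
        have h2 := (Complex.continuous_ofReal.tendsto 0).comp h1
        have h3 : Tendsto (fun y : ℝ => (y : ℂ) * I) (𝓝[>] 0) (𝓝 (((0 : ℝ) : ℂ) * I)) :=
          ((Complex.continuous_ofReal.mul continuous_const).tendsto 0).mono_left nhdsWithin_le_nhds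
        simpa using h2.add h3
      · filter_upwards [self_mem_nhdsWithin] with y hy
        right
        simpa using hy
    · have := (hAc 0 ⟨le_rfl, hπ⟩).tendsto
      rw [hA0] at this
      rw [← nhdsWithin_Ioo_eq_nhdsGT hπ]
      exact this.mono_left (nhdsWithin_mono _ Ioo_subset_Ico_self)
  have hle : ∀ y ∈ Ioo 0 Real.pi, (P 0).im + A y ≤ D b := by
    intro y hy
    have h1 : (P 0).im - 0 ≤ D y - A y := by
      refine le_of_tendsto hzero ?_
      filter_upwards [Ioo_mem_nhdsGT hy.1] with t ht
      exact hmono1 ⟨ht.1, ht.2.trans hy.2⟩ hy ht.2.le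
    have h2 : D y ≤ D b := hmono2 ⟨hy.1, hy.2.le.trans hπb⟩ ⟨hb.1, le_rfl⟩ (hy.2.le.trans hπb)
    linarith
  refine le_of_tendsto (hAlim.const_add _) ?_
  filter_upwards [Ioo_mem_nhdsLT hπ] with y hy using hle y hy

/-! ### Decay at infinity and closing the contour. -/

lemma mul_le_prod {f : ι → ℝ} (hf : ∀ k, 1 ≤ f k) {i j : ι} (hij : i ≠ j) :
    f i * f j ≤ ∏ k, f k := by
  classical
  rw [← Finset.mul_prod_erase _ _ (Finset.mem_univ i),
    ← Finset.mul_prod_erase _ _ (Finset.mem_erase.2 ⟨hij.symm, Finset.mem_univ j⟩), ← mul_assoc]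
  refine le_mul_of_one_le_right ?_ ?_
  swap
  · simpa using Finset.prod_le_prod (s := (Finset.univ.erase i).erase j) (f := fun _ => (1 : ℝ))
      (fun _ _ => zero_le_one) fun k _ => hf k
  exact mul_nonneg (zero_le_one.trans (hf i)) (zero_le_one.trans (hf j))

lemma norm_laplaceProd (u : ι → ℝ) (z : ℂ) :
    ‖laplaceProd u z‖ = Real.exp (-((∑ j, u j) * z.re)) / ∏ j, ‖(1 - u j * z : ℂ)‖ := by
  rw [laplaceProd, norm_prod]
  simp only [norm_div, Complex.norm_exp]
  rw [Finset.prod_div_distrib, ← Real.exp_sum]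
  simp [Finset.sum_mul]

/-- Once `|z| ≥ 2 / |u k|`, the factor `|1 - u k z|` is at least `|u k| |z| / 2` and at least `1`.
Two nonzero coordinates supply the square, and the others only help. -/
lemma exists_norm_laplaceProd_le {i j : ι} (hij : i ≠ j) (hi : u i ≠ 0) (hj : u j ≠ 0) :
    ∃ C R : ℝ, 0 < C ∧ 0 < R ∧ ∀ z : ℂ, R ≤ ‖z‖ →
      ‖laplaceProd u z‖ ≤ C * Real.exp (-((∑ j, u j) * z.re)) / ‖z‖ ^ 2 := by
  have hi' := abs_pos.2 hi
  have hj' := abs_pos.2 hj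
  have hRle : ∀ k, 2 / |u k| ≤ ∑ k, 2 / |u k| := fun k =>
    Finset.single_le_sum (f := fun k => 2 / |u k|) (fun k _ => by positivity) (Finset.mem_univ k)
  refine ⟨4 / (|u i| * |u j|), ∑ k, 2 / |u k|, by positivity,
    (by positivity : 0 < 2 / |u i|).trans_le (hRle i), fun z hz => ?_⟩
  have hlow : ∀ k, u k ≠ 0 → |u k| * ‖z‖ / 2 ≤ ‖(1 - u k * z : ℂ)‖ ∧ 1 ≤ ‖(1 - u k * z : ℂ)‖ := by
    intro k hk
    have hk' := abs_pos.2 hk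
    have h1 := (hRle k).trans hz
    rw [div_le_iff₀ hk'] at h1
    have h2 := norm_sub_norm_le (u k * z : ℂ) 1
    rw [norm_sub_rev, norm_mul, norm_one, Complex.norm_real, Real.norm_eq_abs] at h2
    constructor <;> linarith
  have hone : ∀ k, 1 ≤ ‖(1 - u k * z : ℂ)‖ := by
    intro k
    rcases eq_or_ne (u k) 0 with h | h
    · simp [h]
    · exact (hlow k h).2
  have hz0 : 0 < ‖z‖ := ((by positivity : 0 < 2 / |u i|).trans_le (hRle i)).trans_le hz
  have hprod : |u i| * |u j| * ‖z‖ ^ 2 / 4 ≤ ∏ k, ‖(1 - u k * z : ℂ)‖ := by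
    refine le_trans ?_ (mul_le_prod hone hij)
    refine le_trans (le_of_eq ?_) (mul_le_mul (hlow i hi).1 (hlow j hj).1 (by positivity) (norm_nonneg _))
    ring
  rw [norm_laplaceProd]
  refine (div_le_div_of_nonneg_left (Real.exp_pos _).le (by positivity) hprod).trans (le_of_eq ?_)
  field_simp

lemma norm_sub_le_of_norm_deriv_le_div_sq {f f' : ℝ → ℂ} {C T X : ℝ} (hC : 0 < C) (hT : 0 < T)
    (hX : 0 ≤ X) (hf : ∀ t, HasDerivAt f (f' t) t)
    (hb : ∀ t, 0 ≤ t → ‖f' t‖ ≤ C / (t ^ 2 + T ^ 2)) : ‖f X - f 0‖ ≤ C * Real.pi / T := by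
  have hB : ∀ t, HasDerivAt (fun t => C / T * Real.arctan (t / T)) (C / (t ^ 2 + T ^ 2)) t := by
    intro t
    refine ((((hasDerivAt_id t).div_const T).arctan).const_mul (C / T)).congr_deriv ?_
    simp only [id]
    have : 0 < t ^ 2 + T ^ 2 := by positivity
    have : 0 < T ^ 2 + t ^ 2 := by positivity
    field_simp
    ring
  have h := image_norm_le_of_norm_deriv_right_le_deriv_boundary (f := fun t => f t - f 0) (f' := f')
    (a := 0) (b := X) (fun t _ => ((hf t).sub_const _).continuousAt.continuousWithinAt)
    (fun t _ => ((hf t).sub_const _).hasDerivWithinAt) (by simp) hB (fun t ht => hb t ht.1)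
    (right_mem_Icc.2 hX)
  refine h.trans ?_
  have := (Real.arctan_lt_pi_div_two (X / T)).le
  calc C / T * Real.arctan (X / T) ≤ C / T * Real.pi := by
        refine mul_le_mul_of_nonneg_left ?_ (by positivity)
        linarith [Real.pi_pos]
    _ = _ := by ring

/-- The sign condition keeps the exponential at most `1` along the segment, leaving `C / (t ^ 2 + T
^ 2)`, whose antiderivative is an arctangent. When `∑ u j = 0`, `X` may have either sign. -/
lemma norm_sub_horizontal_le {P : ℂ → ℂ} (hP : IsLaplacePrimitive u P) {C R : ℝ} (hC : 0 < C)
    (hF : ∀ z : ℂ, R ≤ ‖z‖ →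
      ‖laplaceProd u z‖ ≤ C * Real.exp (-((∑ j, u j) * z.re)) / ‖z‖ ^ 2)
    {T X : ℝ} (hT : 0 < T) (hRT : R ≤ T) (hX : 0 ≤ (∑ j, u j) * X) :
    ‖P (X + T * I) - P (T * I)‖ ≤ C * Real.pi / T := by
  have key : ∀ t : ℝ, 0 ≤ (∑ j, u j) * t → ‖laplaceProd u (t + T * I)‖ ≤ C / (t ^ 2 + T ^ 2) := by
    intro t ht
    have hn : ‖(t + T * I : ℂ)‖ ^ 2 = t ^ 2 + T ^ 2 := by
      rw [← Complex.normSq_eq_norm_sq]; simp [Complex.normSq_apply]; ring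
    have hle : T ≤ ‖(t + T * I : ℂ)‖ := by
      have := Complex.abs_im_le_norm (t + T * I : ℂ)
      rw [add_mul_I_im, abs_of_pos hT] at this
      exact this
    refine (hF _ (hRT.trans hle)).trans ?_
    rw [hn]
    refine div_le_div_of_nonneg_right ?_ (by positivity)
    refine mul_le_of_le_one_right hC.le (Real.exp_le_one_iff.2 ?_)
    simpa using ht
  have hd : ∀ t : ℝ, HasDerivAt (fun t : ℝ => P (t + T * I)) (laplaceProd u (t + T * I)) t := by
    intro t
    have := (hP.hasDerivAt (z := t + T * I) (by simpa using hT)).comp t (hasDerivAt_horizontal t T)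
    rwa [mul_one] at this
  rcases le_total 0 X with h | h
  · rcases h.eq_or_lt with rfl | h'
    · simp; positivity
    have hs : 0 ≤ ∑ j, u j := nonneg_of_mul_nonneg_left hX h'
    have := norm_sub_le_of_norm_deriv_le_div_sq hC hT h hd fun t ht => key t (mul_nonneg hs ht)
    simpa using this
  · rcases h.eq_or_lt with rfl | h'
    · simp; positivity
    have hs : ∑ j, u j ≤ 0 := by
      by_contra! hc
      exact absurd hX (not_le.2 (mul_neg_of_pos_of_neg hc h'))
    have hd' : ∀ t : ℝ, HasDerivAt (fun t : ℝ => P ((-t : ℝ) + T * I))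
        (-laplaceProd u ((-t : ℝ) + T * I)) t := by
      intro t
      simpa [Function.comp_def] using (hd (-t)).scomp t (hasDerivAt_neg t)
    have := norm_sub_le_of_norm_deriv_le_div_sq hC hT (neg_nonneg.2 h) hd' fun t ht => by
      rw [norm_neg]
      simpa using key (-t) (mul_nonneg_of_nonpos_of_nonpos hs (neg_nonpos.2 ht))
    simpa using this

/-- If `∑ u j = 0`, the curve reaches every height and is joined to `T * I` horizontally. Otherwise
it exists only below height `p π / ∑ u j`; it is left at height `b` and the contour goes right to
abscissa `X`, vertically to height `T` and back to the imaginary axis. -/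
lemma exists_im_primitive_ge (hu : ∑ j, u j ^ 2 = 1) (hlt : ∀ j, |u j| < 1) (hs : 0 ≤ ∑ j, u j)
    {P : ℂ → ℂ} (hP : IsLaplacePrimitive u P) {C R : ℝ} (hC : 0 < C)
    (hF : ∀ z : ℂ, R ≤ ‖z‖ →
      ‖laplaceProd u z‖ ≤ C * Real.exp (-((∑ j, u j) * z.re)) / ‖z‖ ^ 2)
    {T : ℝ} (hT : Real.pi ≤ T) (hRT : R ≤ T) :
    (P 0).im + Real.pi / Real.exp 1 - C * Real.pi / T ≤ (P (T * I)).im := by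
  have hπ := Real.pi_pos
  have hT0 : 0 < T := hπ.trans_le hT
  have him : ∀ z w : ℂ, z.im - ‖z - w‖ ≤ w.im := by
    intro z w
    have := (le_abs_self _).trans (Complex.abs_im_le_norm (z - w))
    rw [Complex.sub_im] at this
    linarith
  obtain ⟨i, hi⟩ : ∃ i, 0 < u i := by
    by_contra! h
    have h0 : ∑ j, u j = 0 := le_antisymm (Finset.sum_nonpos fun j _ => h j) hs
    obtain ⟨j, hj⟩ := exists_neg_of_sum_eq_zero (u := fun j => -u j) (by simpa using hu)
      (by simpa using h0)
    linarith [h j]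
  set p : ℝ := ((Finset.univ.filter fun j => 0 < u j).card : ℝ) with hp
  have hp0 : 0 < p := by
    rw [hp]
    exact_mod_cast Finset.card_pos.2 ⟨i, by simpa using hi⟩
  have hsp : ∑ j, u j < p := by
    have h1 : ∑ j, u j ≤ ∑ j ∈ Finset.univ.filter fun j => 0 < u j, u j := by
      rw [Finset.sum_filter]
      refine Finset.sum_le_sum fun j _ => ?_
      split_ifs with h
      · exact le_rfl
      · exact not_lt.1 h
    have h2 : ∑ j ∈ Finset.univ.filter (fun j => 0 < u j), u j
        < ∑ j ∈ Finset.univ.filter (fun j => 0 < u j), (1 : ℝ) :=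
      Finset.sum_lt_sum_of_nonempty ⟨i, by simpa using hi⟩ fun j _ => (le_abs_self _).trans_lt (hlt j)
    refine h1.trans_lt (h2.trans_le ?_)
    simp [hp]
  rcases hs.eq_or_lt with h0 | hspos
  · have hadm : IsAdmissible u T := ⟨hT0, by rw [← h0, mul_zero]; positivity⟩
    have h1 := le_im_primitive_descentCurve hu hs hP hadm hT
    have h2 := norm_sub_horizontal_le hP hC hF hT0 hRT (X := descentCurve u T) (by rw [← h0, zero_mul])
    have h3 := him (P (descentCurve u T + T * I)) (P (T * I))
    linarith
  -- At this height the phase limit `p π - b ∑ u j` at `+∞` is at most `π`, so to the right of the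
  -- curve the phase stays in `[0, π]` and `Im F ≥ 0`. Both entries of the maximum are admissible,
  -- the first because `∑ u j < p`.
  set b := max Real.pi ((p - 1) * Real.pi / ∑ j, u j) with hb
  have hπb : Real.pi ≤ b := le_max_left _ _
  have hb0 : 0 < b := hπ.trans_le hπb
  have hadm : IsAdmissible u b := by
    refine ⟨hb0, ?_⟩
    rw [← lt_div_iff₀ hspos, hb, max_lt_iff, lt_div_iff₀ hspos]
    constructor
    · rw [mul_comm]; exact mul_lt_mul_of_pos_right hsp hπ
    · refine div_lt_div_of_pos_right ?_ hspos
      exact mul_lt_mul_of_pos_right (by linarith) hπ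
  have h1 := le_im_primitive_descentCurve hu hs hP hadm hπb
  have hphase : ∀ x : ℝ, (logProd u (x + b * I)).im ≤ Real.pi := by
    intro x
    refine ((strictMono_im_logProd hu hb0).monotone.ge_of_tendsto
      (tendsto_logProd_im_atTop u hb0) x).trans ?_
    have : (p - 1) * Real.pi ≤ b * ∑ j, u j := by
      rw [← div_le_iff₀ hspos]; exact le_max_right _ _
    linarith
  have hhor : ∀ X : ℝ, descentCurve u b ≤ X →
      (P (descentCurve u b + b * I)).im ≤ (P (X + b * I)).im := by
    have hd : ∀ t : ℝ, HasDerivAt (fun t : ℝ => (P (t + b * I)).im)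
        (laplaceProd u (t + b * I)).im t := by
      intro t
      have := (hP.hasDerivAt (z := t + b * I) (by simpa using hb0)).comp t (hasDerivAt_horizontal t b)
      rw [mul_one] at this
      exact hasDerivAt_im this
    have hm : MonotoneOn (fun t : ℝ => (P (t + b * I)).im) (Ici (descentCurve u b)) := by
      refine monotoneOn_of_hasDerivWithinAt_nonneg (convex_Ici _)
        (fun t _ => (hd t).continuousAt.continuousWithinAt)
        (fun t _ => (hd t).hasDerivWithinAt) fun t ht => ?_
      have ht := interior_subset ht
      rw [← exp_logProd (by simpa using hb0), Complex.exp_im]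
      refine mul_nonneg (Real.exp_pos _).le (Real.sin_nonneg_of_nonneg_of_le_pi ?_ (hphase t))
      rw [← im_logProd_descentCurve hu hs hadm]
      exact (strictMono_im_logProd hu hb0).monotone ht
    exact fun X hX => hm self_mem_Ici hX hX
  have hver : ∀ X : ℝ, 0 < X → R ≤ X → ‖P (X + b * I) - P (X + T * I)‖ ≤ C / X ^ 2 * |b - T| := by
    intro X hX hRX
    have hd : ∀ t : ℝ, 0 < t → HasDerivAt (fun t : ℝ => P (X + t * I)) (laplaceProd u (X + t * I) * I) t :=
      fun t ht => (hP.hasDerivAt (z := X + t * I) (by simpa using ht)).comp t (hasDerivAt_vertical X t)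
    have := (convex_Ioi (0 : ℝ)).norm_image_sub_le_of_norm_hasDerivWithin_le
      (f := fun t : ℝ => P (X + t * I)) (C := C / X ^ 2)
      (fun t ht => (hd t ht).hasDerivWithinAt) (fun t _ => ?_) hT0 hb0
    · simpa using this
    · rw [norm_mul, Complex.norm_I, mul_one]
      have hle : X ≤ ‖(X + t * I : ℂ)‖ := by
        have := Complex.abs_re_le_norm (X + t * I : ℂ)
        simp only [Complex.add_re, Complex.ofReal_re, Complex.mul_re, Complex.I_re, mul_zero,
          Complex.ofReal_im, Complex.I_im, zero_mul, sub_zero, add_zero, abs_of_pos hX] at this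
        exact this
      refine (hF _ (hRX.trans hle)).trans ?_
      refine div_le_div₀ hC.le ?_ (by positivity) (pow_le_pow_left₀ hX.le hle 2)
      refine mul_le_of_le_one_right hC.le (Real.exp_le_one_iff.2 ?_)
      simp
      positivity
  -- The vertical side costs `C |b - T| / X ^ 2`, which disappears as `X → ∞` with `T` fixed.
  have hlim : Tendsto (fun X : ℝ => (P 0).im + Real.pi / Real.exp 1 - C * Real.pi / T
      - C / X ^ 2 * |b - T|) atTop (𝓝 ((P 0).im + Real.pi / Real.exp 1 - C * Real.pi / T - 0)) := by
    refine Tendsto.const_sub _ ?_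
    have := ((tendsto_pow_atTop (α := ℝ) two_ne_zero).const_div_atTop C).mul_const |b - T|
    simpa using this
  rw [sub_zero] at hlim
  refine le_of_tendsto hlim ?_
  filter_upwards [eventually_gt_atTop 0, eventually_ge_atTop R,
    eventually_ge_atTop (descentCurve u b)] with X hX0 hXR hXb
  have h2 := norm_sub_horizontal_le hP hC hF hT0 hRT (X := X) (by positivity)
  have h3 := him (P (X + T * I)) (P (T * I))
  have h4 := him (P (X + b * I)) (P (X + T * I))
  have h5 := hver X hX0 hXR
  have h6 := hhor X hXb
  linarith

/-! ### The integral over the imaginary axis. -/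

lemma one_sub_mul_I_ne_zero (a t : ℝ) : 1 - a * (t * I : ℂ) ≠ 0 := by
  intro h
  simpa using congrArg Complex.re h

lemma continuous_laplaceProd_mul_I (u : ι → ℝ) : Continuous fun t : ℝ => laplaceProd u (t * I) := by
  unfold laplaceProd
  refine continuous_finsetProd _ fun j _ => ?_
  exact Continuous.div (by fun_prop) (by fun_prop) fun t => one_sub_mul_I_ne_zero _ _

lemma laplaceProd_conj (u : ι → ℝ) (t : ℝ) :
    laplaceProd u ((-t : ℝ) * I) = starRingEnd ℂ (laplaceProd u (t * I)) := by
  simp [laplaceProd, map_prod, ← Complex.exp_conj]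

lemma laplaceProd_neg (u : ι → ℝ) (t : ℝ) :
    laplaceProd (fun j => -u j) (t * I) = laplaceProd u ((-t : ℝ) * I) := by
  simp [laplaceProd]

lemma exists_pair (hu : ∑ j, u j ^ 2 = 1) (hlt : ∀ j, |u j| < 1) :
    ∃ i j, i ≠ j ∧ u i ≠ 0 ∧ u j ≠ 0 := by
  obtain ⟨i, hi⟩ : ∃ i, u i ≠ 0 := by
    by_contra! h
    simp [h] at hu
  refine ⟨i, ?_⟩
  by_contra! h
  rw [Finset.sum_eq_single i (fun j _ hj => by rw [h j hj.symm hi]; simp) (by simp)] at hu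
  have := hlt i
  rw [← sq_abs] at hu
  nlinarith [abs_nonneg (u i)]

lemma integrable_laplaceProd (hu : ∑ j, u j ^ 2 = 1) (hlt : ∀ j, |u j| < 1) :
    Integrable fun t : ℝ => laplaceProd u (t * I) := by
  obtain ⟨i, j, hij, hi, hj⟩ := exists_pair hu hlt
  set m := min |u i| |u j| with hm
  have hm0 : 0 < m := lt_min (abs_pos.2 hi) (abs_pos.2 hj)
  refine ((integrable_inv_one_add_sq.comp_mul_left' hm0.ne')).mono'
    (continuous_laplaceProd_mul_I u).aestronglyMeasurable (Eventually.of_forall fun t => ?_)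
  have hsq : ∀ k, ‖(1 - u k * (t * I) : ℂ)‖ ^ 2 = 1 + u k ^ 2 * t ^ 2 := by
    intro k
    rw [← Complex.normSq_eq_norm_sq]; simp [Complex.normSq_apply]; ring
  have h1 : ∀ k, 1 ≤ ‖(1 - u k * (t * I) : ℂ)‖ := by
    intro k
    rw [← one_le_sq_iff₀ (norm_nonneg _), hsq]
    nlinarith [mul_nonneg (sq_nonneg (u k)) (sq_nonneg t)]
  have hge : ∀ k, m ≤ |u k| → Real.sqrt (1 + (m * t) ^ 2) ≤ ‖(1 - u k * (t * I) : ℂ)‖ := by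
    intro k hk
    refine Real.sqrt_le_iff.2 ⟨norm_nonneg _, ?_⟩
    rw [hsq, mul_pow, ← sq_abs (u k)]
    have := pow_le_pow_left₀ hm0.le hk 2
    nlinarith [sq_nonneg t]
  have hprod : 1 + (m * t) ^ 2 ≤ ∏ k, ‖(1 - u k * (t * I) : ℂ)‖ := by
    refine le_trans ?_ (mul_le_prod h1 hij)
    rw [← Real.mul_self_sqrt (show 0 ≤ 1 + (m * t) ^ 2 by positivity)]
    exact mul_le_mul (hge i (min_le_left _ _)) (hge j (min_le_right _ _)) (Real.sqrt_nonneg _)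
      (norm_nonneg _)
  rw [norm_laplaceProd]
  simp only [Complex.mul_re, Complex.ofReal_re, Complex.I_re, mul_zero, Complex.ofReal_im,
    zero_mul, sub_zero, neg_zero, Real.exp_zero, one_div]
  exact inv_anti₀ (by positivity) hprod

lemma integral_laplaceProd_ge_of_sum_nonneg (hu : ∑ j, u j ^ 2 = 1) (hlt : ∀ j, |u j| < 1)
    (hs : 0 ≤ ∑ j, u j) :
    2 * Real.pi / Real.exp 1 ≤ ∫ t : ℝ, (laplaceProd u (t * I)).re := by
  obtain ⟨i, j, hij, hi, hj⟩ := exists_pair hu hlt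
  obtain ⟨P, hP⟩ := exists_isLaplacePrimitive u
  obtain ⟨C, R, hC, hR, hF⟩ := exists_norm_laplaceProd_le hij hi hj
  have hint : Integrable fun t : ℝ => (laplaceProd u (t * I)).re := (integrable_laplaceProd hu hlt).re
  have hcont : Continuous fun t : ℝ => (laplaceProd u (t * I)).re :=
    Complex.continuous_re.comp (continuous_laplaceProd_mul_I u)
  have hFTC : ∀ T : ℝ, 0 ≤ T →
      ∫ t in (0 : ℝ)..T, (laplaceProd u (t * I)).re = (P (T * I)).im - (P 0).im := by
    intro T hT
    have hmem : ∀ t : ℝ, 0 ≤ t → (t * I : ℂ) ∈ insert (0 : ℂ) {z : ℂ | 0 < z.im} := by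
      intro t ht
      rcases ht.eq_or_lt with rfl | ht
      · left; simp
      · right; simpa using ht
    have := intervalIntegral.integral_eq_sub_of_hasDerivAt_of_le (f := fun t : ℝ => (P (t * I)).im)
      (f' := fun t : ℝ => (laplaceProd u (t * I)).re) hT ?_ ?_ (hcont.intervalIntegrable _ _)
    · simpa using this
    · refine Complex.continuous_im.comp_continuousOn ?_
      refine ContinuousOn.comp (g := P) (fun z hz => (hP z hz).continuousWithinAt) (by fun_prop)
        fun t ht => hmem t ht.1
    · intro t ht
      have hd := hasDerivAt_vertical 0 t
      simp only [Complex.ofReal_zero, zero_add] at hd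
      refine (hasDerivAt_im ((hP.hasDerivAt (by simpa using ht.1)).comp t hd)).congr_deriv ?_
      simp
  have hlim := intervalIntegral_tendsto_integral_Ioi 0 hint.integrableOn tendsto_id
  have hhalf : Real.pi / Real.exp 1 ≤ ∫ t in Ioi (0 : ℝ), (laplaceProd u (t * I)).re := by
    have hl : Tendsto (fun T : ℝ => Real.pi / Real.exp 1 - C * Real.pi / T) atTop
        (𝓝 (Real.pi / Real.exp 1 - 0)) :=
      Tendsto.const_sub _ (tendsto_id.const_div_atTop _)
    rw [sub_zero] at hl
    refine le_of_tendsto_of_tendsto hl hlim ?_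
    filter_upwards [eventually_ge_atTop Real.pi, eventually_ge_atTop R] with T hT hRT
    have h1 := exists_im_primitive_ge hu hlt hs hP hC hF hT hRT
    rw [id, hFTC T (Real.pi_pos.le.trans hT)]
    linarith
  have hneg : ∫ t in Iic (0 : ℝ), (laplaceProd u (t * I)).re
      = ∫ t in Ioi (0 : ℝ), (laplaceProd u (t * I)).re := by
    rw [← neg_zero, ← integral_comp_neg_Iic, neg_zero]
    refine setIntegral_congr_fun measurableSet_Iic fun t _ => ?_
    simp only [laplaceProd_conj, Complex.conj_re]
  rw [← intervalIntegral.integral_Iic_add_Ioi hint.integrableOn hint.integrableOn (b := 0), hneg]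
  have : 2 * Real.pi / Real.exp 1 = Real.pi / Real.exp 1 + Real.pi / Real.exp 1 := by ring
  linarith

/-- The Fourier-analytic form of the slicing inequality. -/
lemma integral_laplaceProd_ge (hu : ∑ j, u j ^ 2 = 1) (hlt : ∀ j, |u j| < 1) :
    2 * Real.pi / Real.exp 1 ≤ ∫ t : ℝ, (laplaceProd u (t * I)).re := by
  rcases le_total 0 (∑ j, u j) with hs | hs
  · exact integral_laplaceProd_ge_of_sum_nonneg hu hlt hs
  · have := integral_laplaceProd_ge_of_sum_nonneg (u := fun j => -u j) (by simpa using hu)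
      (by simpa using hlt) (by simpa using hs)
    simpa only [laplaceProd_neg, laplaceProd_conj, Complex.conj_re] using this

end Contour

/-! ### Densities and characteristic functions of the summands. -/

lemma eq_of_ae_eq_of_continuousAt {f g : ℝ → ℝ} {x : ℝ} (h : f =ᵐ[volume] g)
    (hf : ContinuousAt f x) (hg : ContinuousAt g x) : f x = g x := by
  have hd : Dense {t | f t = g t} := Measure.dense_of_ae h
  have := mem_closure_iff_nhdsWithin_neBot.1 (hd x)
  refine tendsto_nhds_unique (hf.tendsto.mono_left (nhdsWithin_le_nhds (s := {t | f t = g t}))) ?_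
  refine (hg.tendsto.mono_left (nhdsWithin_le_nhds (s := {t | f t = g t}))).congr' ?_
  filter_upwards [self_mem_nhdsWithin] with t ht using ht.symm

lemma IsDensityOf.unique_of_continuousAt {Ω : Type*} [MeasurableSpace Ω] {μ : Measure Ω}
    {X : Ω → ℝ} {f g : ℝ → ℝ} {x : ℝ} (hf : IsDensityOf μ X f) (hg : IsDensityOf μ X g)
    (hfx : ContinuousAt f x) (hgx : ContinuousAt g x) : f x = g x := by
  have h := hf.2.2.symm.trans hg.2.2
  rw [withDensity_eq_iff_of_sigmaFinite hf.1.ennreal_ofReal.aemeasurable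
    hg.1.ennreal_ofReal.aemeasurable] at h
  refine eq_of_ae_eq_of_continuousAt ?_ hfx hgx
  filter_upwards [h] with t ht
  exact (ENNReal.ofReal_eq_ofReal_iff (hf.2.1 t) (hg.2.1 t)).1 ht

lemma map_withDensity_mul_sub_one {f : ℝ → ENNReal} (hf : Measurable f) {u : ℝ} (hu : u ≠ 0) :
    (volume.withDensity f).map (fun y => u * (y - 1))
      = volume.withDensity fun t => ENNReal.ofReal |u|⁻¹ * f (t / u + 1) := by
  ext s hs
  have hm : Measurable fun y : ℝ => u * (y - 1) := by fun_prop
  rw [Measure.map_apply hm hs, withDensity_apply _ (hm hs), withDensity_apply _ hs,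
    ← lintegral_indicator (hm hs), ← lintegral_indicator hs]
  have hmeas : Measurable (s.indicator fun t => ENNReal.ofReal |u|⁻¹ * f (t / u + 1)) :=
    Measurable.indicator (by fun_prop) hs
  conv_rhs => rw [← Real.smul_map_volume_mul_left hu]
  rw [lintegral_smul_measure, lintegral_map hmeas (by fun_prop),
    ← lintegral_add_right_eq_self _ (1 : ℝ), smul_eq_mul, ← lintegral_const_mul]
  · refine lintegral_congr fun y => ?_
    have h1 : ENNReal.ofReal |u| * ENNReal.ofReal |u|⁻¹ = 1 := by
      rw [← ENNReal.ofReal_mul (abs_nonneg u), mul_inv_cancel₀ (abs_ne_zero.2 hu), ENNReal.ofReal_one]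
    have h2 : u * y / u + 1 = y + 1 := by field_simp
    have h3 : y + 1 ∈ (fun y => u * (y - 1)) ⁻¹' s ↔ u * y ∈ s := by simp
    by_cases h : u * y ∈ s
    · rw [indicator_of_mem h, indicator_of_mem (h3.2 h), h2, ← mul_assoc, h1, one_mul]
    · rw [indicator_of_notMem h, indicator_of_notMem (mt h3.1 h), mul_zero]
  · exact hmeas.comp (by fun_prop)

/-- The density of `u (Y - 1)` for `Y` standard exponential and `u ≠ 0`. -/
noncomputable def scaledExpDensity (u t : ℝ) : ℝ :=
  |u|⁻¹ * if 0 ≤ t / u + 1 then Real.exp (-(t / u + 1)) else 0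

lemma scaledExpDensity_nonneg (u t : ℝ) : 0 ≤ scaledExpDensity u t := by
  unfold scaledExpDensity
  split_ifs <;> positivity

lemma scaledExpDensity_le (u t : ℝ) : scaledExpDensity u t ≤ |u|⁻¹ := by
  unfold scaledExpDensity
  refine mul_le_of_le_one_right (by positivity) ?_
  split_ifs with h
  · exact Real.exp_le_one_iff.2 (by linarith)
  · exact zero_le_one

lemma measurable_scaledExpDensity (u : ℝ) : Measurable (scaledExpDensity u) := by
  unfold scaledExpDensity
  refine Measurable.const_mul (Measurable.ite ?_ (by fun_prop) measurable_const) _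
  exact measurableSet_le measurable_const (by fun_prop)

lemma continuousAt_scaledExpDensity {u t : ℝ} (hu : u ≠ 0) (ht : t ≠ -u) :
    ContinuousAt (scaledExpDensity u) t := by
  have hc : Continuous fun t : ℝ => t / u + 1 := by fun_prop
  have h0 : t / u + 1 ≠ 0 := by
    intro h
    apply ht
    field_simp at h
    linarith
  rcases lt_or_gt_of_ne h0 with h | h
  · refine (continuousAt_const (y := (0 : ℝ))).congr ?_
    filter_upwards [hc.continuousAt.eventually_lt_const h] with s hs
    simp [scaledExpDensity, not_le.2 hs]
  · have : Continuous fun t : ℝ => |u|⁻¹ * Real.exp (-(t / u + 1)) := by fun_prop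
    refine this.continuousAt.congr ?_
    filter_upwards [hc.continuousAt.eventually_const_lt h] with s hs
    simp [scaledExpDensity, hs.le]

lemma expMeasure_one_eq :
    expMeasure 1 = volume.withDensity fun x => ENNReal.ofReal (if 0 ≤ x then Real.exp (-x) else 0) := by
  change volume.withDensity (exponentialPDF 1) = _
  congr 1
  ext x
  rw [exponentialPDF_eq]
  simp

lemma map_expMeasure_eq {u : ℝ} (hu : u ≠ 0) :
    (expMeasure 1).map (fun y => u * (y - 1))
      = volume.withDensity fun t => ENNReal.ofReal (scaledExpDensity u t) := by
  have hm : Measurable fun x : ℝ => ENNReal.ofReal (if 0 ≤ x then Real.exp (-x) else 0) :=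
    (Measurable.ite measurableSet_Ici (by fun_prop) measurable_const).ennreal_ofReal
  rw [expMeasure_one_eq, map_withDensity_mul_sub_one hm hu]
  congr 1
  ext t
  rw [scaledExpDensity, ENNReal.ofReal_mul (by positivity)]

lemma charFun_expMeasure_one (t : ℝ) : charFun (expMeasure 1) t = 1 / (1 - t * I) := by
  rw [charFun_apply_real, expMeasure_one_eq, integral_withDensity_eq_integral_toReal_smul
    (Measurable.ite measurableSet_Ici (by fun_prop) measurable_const).ennreal_ofReal
    (ae_of_all _ fun _ => ENNReal.ofReal_lt_top)]
  have h1 : ∀ x : ℝ, (ENNReal.ofReal (if 0 ≤ x then Real.exp (-x) else 0)).toReal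
      • Complex.exp (t * x * I) = (Ici (0 : ℝ)).indicator (fun x : ℝ => Complex.exp ((-1 + t * I) * x)) x := by
    intro x
    by_cases hx : 0 ≤ x
    · rw [if_pos hx, indicator_of_mem (mem_Ici.2 hx), ENNReal.toReal_ofReal (Real.exp_pos _).le,
        Complex.real_smul, Complex.ofReal_exp, ← Complex.exp_add]
      congr 1; push_cast; ring
    · rw [if_neg hx, indicator_of_notMem (by simpa using hx)]; simp
  simp_rw [h1]
  rw [integral_indicator measurableSet_Ici, integral_Ici_eq_integral_Ioi,
    integral_exp_mul_complex_Ioi (by simp)]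
  have h2 : (-1 + t * I : ℂ) ≠ 0 := fun h => by simpa using congrArg Complex.re h
  have h3 : (1 - t * I : ℂ) ≠ 0 := fun h => by simpa using congrArg Complex.re h
  simp only [Complex.ofReal_zero, mul_zero, Complex.exp_zero]
  field_simp
  ring

lemma charFun_map_mul_sub_one (u t : ℝ) :
    charFun ((expMeasure 1).map fun y => u * (y - 1)) t
      = Complex.exp (-(u * (t * I))) / (1 - u * (t * I)) := by
  have h1 : (expMeasure 1).map (fun y => u * (y - 1)) = ((expMeasure 1).map (fun y => u * y)).map (fun y => y + -u) := by
    rw [Measure.map_map (by fun_prop) (by fun_prop)]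
    congr 1; ext y; simp; ring
  rw [h1, charFun_map_add_const, charFun_map_mul, charFun_expMeasure_one]
  simp only [RCLike.inner_apply, conj_trivial]
  push_cast
  rw [div_mul_eq_mul_div, one_mul]
  congr 2 <;> ring

/-! ### Continuous densities of sums and Fourier inversion. -/

/-- The density is the average of translates of `f`. Dominated convergence applies because the only
bad translate for a given `t` is `b = t - c`, a null set for an absolutely continuous `ρ`. -/
lemma exists_continuous_density_conv {ρ : Measure ℝ} [IsProbabilityMeasure ρ] (hρ : ρ ≪ volume)
    {f : ℝ → ℝ} (hf : Measurable f) (hf0 : ∀ t, 0 ≤ f t) {M c : ℝ} (hM : ∀ t, f t ≤ M)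
    (hfc : ∀ t, t ≠ c → ContinuousAt f t) :
    ∃ g : ℝ → ℝ, (∀ t, 0 ≤ g t) ∧ Continuous g ∧
      ρ.conv (volume.withDensity fun t => ENNReal.ofReal (f t))
        = volume.withDensity fun t => ENNReal.ofReal (g t) := by
  refine ⟨fun t => ∫ b, f (-b + t) ∂ρ, fun t => integral_nonneg fun b => hf0 _, ?_, ?_⟩
  · refine continuous_iff_continuousAt.2 fun t => ?_
    refine continuousAt_of_dominated (bound := fun _ => M) ?_ ?_ (integrable_const _) ?_
    · exact Eventually.of_forall fun s => (hf.comp (by fun_prop)).aestronglyMeasurable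
    · refine Eventually.of_forall fun s => ae_of_all _ fun b => ?_
      rw [Real.norm_of_nonneg (hf0 _)]; exact hM _
    · have h0 : ρ {t - c} = 0 := hρ (by simp)
      filter_upwards [compl_mem_ae_iff.2 h0] with b hb
      have hb' : -b + t ≠ c := by
        intro h; apply hb; show b = t - c; linarith
      exact ContinuousAt.comp (f := fun s : ℝ => -b + s) (hfc _ hb') (by fun_prop)
  · conv_lhs => rw [← Measure.withDensity_rnDeriv_eq ρ volume hρ]
    rw [conv_withDensity_eq_lconvolution (Measure.measurable_rnDeriv _ _) hf.ennreal_ofReal]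
    congr 1
    ext t
    have hmeas : Measurable fun b => ENNReal.ofReal (f (-b + t)) :=
      (hf.comp (by fun_prop)).ennreal_ofReal
    rw [lconvolution_def, ofReal_integral_eq_lintegral_ofReal]
    · conv_rhs => rw [← Measure.withDensity_rnDeriv_eq ρ volume hρ]
      rw [lintegral_withDensity_eq_lintegral_mul _ (Measure.measurable_rnDeriv _ _) hmeas]
      rfl
    · refine Integrable.of_bound (C := M) (hf.comp (by fun_prop)).aestronglyMeasurable
        (ae_of_all _ fun b => ?_)
      rw [Real.norm_of_nonneg (hf0 _)]; exact hM _
    · exact ae_of_all _ fun b => hf0 _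

section CenteredSum

variable {n : ℕ} {Ω : Type*} [MeasurableSpace Ω] {μ : Measure Ω}
  {Y : Fin (n + 1) → Ω → ℝ}

lemma map_mul_sub_one_eq (hlaw : ∀ j, HasLaw (Y j) (expMeasure 1) μ) (a : ℝ) (j : Fin (n + 1)) :
    μ.map (fun ω => a * (Y j ω - 1)) = (expMeasure 1).map fun y => a * (y - 1) := by
  rw [← (hlaw j).map_eq, AEMeasurable.map_map_of_aemeasurable (by fun_prop) (hlaw j).aemeasurable]
  rfl

lemma iIndepFun_mul_sub_one (hindep : iIndepFun Y μ) (u : Fin (n + 1) → ℝ) :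
    iIndepFun (fun j ω => u j * (Y j ω - 1)) μ :=
  hindep.comp (fun j y => u j * (y - 1)) fun j => by fun_prop

lemma charFun_centeredSum (hindep : iIndepFun Y μ) (hlaw : ∀ j, HasLaw (Y j) (expMeasure 1) μ)
    (u : EuclideanSpace ℝ (Fin (n + 1))) (t : ℝ) :
    charFun (μ.map (centeredSum u Y)) t = laplaceProd (fun j => u j) (t * I) := by
  have hm : ∀ j, AEMeasurable (fun ω => u j * (Y j ω - 1)) μ := fun j => by
    have := (hlaw j).aemeasurable
    fun_prop
  have h := (iIndepFun_mul_sub_one hindep fun j => u j).charFun_map_fun_sum_eq_prod hm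
  unfold centeredSum
  rw [h, Finset.prod_apply, laplaceProd]
  refine Finset.prod_congr rfl fun j _ => ?_
  rw [map_mul_sub_one_eq hlaw, charFun_map_mul_sub_one]

/-- The summand `i` supplies a bounded density with a single jump; the summand `j` makes the law of
the remaining sum absolutely continuous. -/
lemma exists_continuous_density_centeredSum [IsProbabilityMeasure μ] (hindep : iIndepFun Y μ)
    (hlaw : ∀ j, HasLaw (Y j) (expMeasure 1) μ) (u : EuclideanSpace ℝ (Fin (n + 1)))
    {i j : Fin (n + 1)} (hij : i ≠ j) (hi : u i ≠ 0) (hj : u j ≠ 0) :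
    ∃ g : ℝ → ℝ, IsDensityOf μ (centeredSum u Y) g ∧ Continuous g := by
  set X : Fin (n + 1) → Ω → ℝ := fun j ω => u j * (Y j ω - 1) with hX
  have hm : ∀ j, AEMeasurable (X j) μ := fun j => by
    have := (hlaw j).aemeasurable
    fun_prop
  have hXind : iIndepFun X μ := iIndepFun_mul_sub_one hindep fun j => u j
  have hlawX : ∀ j, u j ≠ 0 → μ.map (X j)
      = volume.withDensity fun t => ENNReal.ofReal (scaledExpDensity (u j) t) := fun j hj => by
    rw [hX, map_mul_sub_one_eq hlaw, map_expMeasure_eq hj]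
  set B : Ω → ℝ := ∑ k ∈ Finset.univ.erase i, X k with hB
  have hBm : AEMeasurable B μ := Finset.aemeasurable_sum _ fun k _ => hm k
  have hBac : μ.map B ≪ volume := by
    have h1 : B = (∑ k ∈ (Finset.univ.erase i).erase j, X k) + X j := by
      rw [hB, Finset.sum_erase_add _ _ (Finset.mem_erase.2 ⟨hij.symm, Finset.mem_univ j⟩)]
    have h2 := (hXind.indepFun_finsetSum_of_notMem₀ hm
      (Finset.notMem_erase j (Finset.univ.erase i))).map_add_eq_map_conv_map₀
      (Finset.aemeasurable_sum _ fun k _ => hm k) (hm j)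
    rw [h1, h2]
    refine Measure.conv_absolutelyContinuous ?_
    rw [hlawX j hj]
    exact withDensity_absolutelyContinuous _ _
  have hsum : centeredSum u Y = B + X i := by
    rw [hB, Finset.sum_erase_add _ _ (Finset.mem_univ i)]
    ext ω
    simp [centeredSum, hX]
  have hlawZ : μ.map (centeredSum u Y) = (μ.map B).conv (μ.map (X i)) := by
    rw [hsum]
    exact (hXind.indepFun_finsetSum_of_notMem₀ hm
      (Finset.notMem_erase i Finset.univ)).map_add_eq_map_conv_map₀ hBm (hm i)
  have := Measure.isProbabilityMeasure_map hBm
  obtain ⟨g, hg0, hgc, hg⟩ := exists_continuous_density_conv hBac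
    (measurable_scaledExpDensity (u i)) (scaledExpDensity_nonneg (u i)) (scaledExpDensity_le (u i))
    (c := -u i) fun t ht => continuousAt_scaledExpDensity hi ht
  refine ⟨g, ⟨hgc.measurable, hg0, ?_⟩, hgc⟩
  rw [hlawZ, hlawX i hi, hg]

open scoped FourierTransform in
/-- Fourier inversion for a density with integrable characteristic function. -/
lemma IsDensityOf.eq_integral_charFun [IsProbabilityMeasure μ] {Z : Ω → ℝ} (hZ : AEMeasurable Z μ)
    {g : ℝ → ℝ} (hg : IsDensityOf μ Z g) (hg0 : ContinuousAt g 0)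
    (hint : Integrable (charFun (μ.map Z))) :
    (g 0 : ℂ) = (2 * Real.pi : ℝ)⁻¹ * ∫ t : ℝ, charFun (μ.map Z) t := by
  have hprob := Measure.isProbabilityMeasure_map hZ
  have hgi : Integrable g := by
    refine ⟨hg.1.aestronglyMeasurable, ?_⟩
    rw [hasFiniteIntegral_iff_ofReal (ae_of_all _ hg.2.1)]
    have h1 : μ.map Z univ = 1 := measure_univ
    rw [hg.2.2, withDensity_apply _ MeasurableSet.univ, Measure.restrict_univ] at h1
    rw [h1]
    exact ENNReal.one_lt_top
  -- The Fourier kernel is `exp (-2πi x ξ)`; the rescaling produces the factor `1 / (2π)`.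
  have hF : 𝓕 (fun t => (g t : ℂ)) = fun ξ => charFun (μ.map Z) (-(2 * Real.pi) * ξ) := by
    ext ξ
    rw [Real.fourier_real_eq_integral_exp_smul, charFun_apply_real, hg.2.2,
      integral_withDensity_eq_integral_toReal_smul hg.1.ennreal_ofReal
        (ae_of_all _ fun _ => ENNReal.ofReal_lt_top)]
    refine integral_congr_ae (ae_of_all _ fun x => ?_)
    simp only [ENNReal.toReal_ofReal (hg.2.1 x), Complex.real_smul, smul_eq_mul]
    rw [mul_comm]
    congr 2
    push_cast
    ring
  have hne : -(2 * Real.pi) ≠ 0 := by simp [Real.pi_ne_zero]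
  have hFi : Integrable (𝓕 (fun t => (g t : ℂ))) := by
    rw [hF]; exact hint.comp_mul_left' hne
  have hinv := (hgi.ofReal (𝕜 := ℂ)).fourierInv_fourier_eq hFi (v := 0)
    (Complex.continuous_ofReal.continuousAt.comp hg0)
  rw [Real.fourierInv_eq'] at hinv
  simp only [inner_zero_right, mul_zero, Complex.ofReal_zero, zero_mul, Complex.exp_zero,
    one_smul] at hinv
  refine hinv.symm.trans ?_
  change ∫ v, 𝓕 (fun t => (g t : ℂ)) v = _
  rw [hF, Measure.integral_comp_mul_left (fun t => charFun (μ.map Z) t), Complex.real_smul, abs_inv, abs_neg,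
    abs_of_pos (by positivity)]

end CenteredSum

end SimplexSlicing

/-- The density is defined only up to null sets; its value at `0` means the value at `0` of a
version that is continuous at `0`. Such a version exists, and any two of them agree at `0`. -/
theorem theorem1p2 (n : ℕ) {Ω : Type*} [MeasurableSpace Ω] (μ : Measure Ω)
    [IsProbabilityMeasure μ] (Y : Fin (n + 1) → Ω → ℝ)
    (hindep : iIndepFun Y μ) (hlaw : ∀ j, HasLaw (Y j) (expMeasure 1) μ)
    (u : EuclideanSpace ℝ (Fin (n + 1))) (hu : ‖u‖ = 1) :
    (∃ g : ℝ → ℝ, IsDensityOf μ (centeredSum u Y) g ∧ ContinuousAt g 0) ∧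
    (∀ g : ℝ → ℝ, IsDensityOf μ (centeredSum u Y) g → ContinuousAt g 0 →
      1 / Real.exp 1 ≤ g 0 ∧
      ((∃ j, u = EuclideanSpace.single j 1 ∨ u = EuclideanSpace.single j (-1)) →
        g 0 = 1 / Real.exp 1)) := by
  have hsq : ∑ j, u j ^ 2 = 1 := by
    have := EuclideanSpace.norm_sq_eq u
    rw [hu] at this
    simpa using this.symm
  have hle : ∀ j, u j ^ 2 ≤ 1 := fun j => hsq ▸
    Finset.single_le_sum (f := fun j => u j ^ 2) (fun i _ => sq_nonneg _) (Finset.mem_univ j)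
  by_cases hlt : ∀ j, |u j| < 1
  · obtain ⟨i, j, hij, hi, hj⟩ := SimplexSlicing.exists_pair hsq hlt
    obtain ⟨g₀, hg₀, hg₀c⟩ :=
      SimplexSlicing.exists_continuous_density_centeredSum hindep hlaw u hij hi hj
    refine ⟨⟨g₀, hg₀, hg₀c.continuousAt⟩, fun g hg hgc => ⟨?_, ?_⟩⟩
    · have hZ : AEMeasurable (centeredSum u Y) μ := by
        refine Finset.aemeasurable_fun_sum _ fun j _ => ?_
        have := (hlaw j).aemeasurable
        fun_prop
      have hchar : charFun (μ.map (centeredSum u Y))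
          = fun t : ℝ => SimplexSlicing.laplaceProd (fun j => u j) (t * Complex.I) :=
        funext (SimplexSlicing.charFun_centeredSum hindep hlaw u)
      have hint := SimplexSlicing.integrable_laplaceProd hsq hlt
      have h := SimplexSlicing.IsDensityOf.eq_integral_charFun hZ hg hgc (hchar ▸ hint)
      rw [hchar] at h
      have hre := congrArg Complex.re h
      rw [Complex.ofReal_re, Complex.re_ofReal_mul] at hre
      have hre' : (∫ t : ℝ, SimplexSlicing.laplaceProd (fun j => u j) (t * Complex.I)).re
          = ∫ t : ℝ, (SimplexSlicing.laplaceProd (fun j => u j) (t * Complex.I)).re :=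
        (integral_re hint).symm
      rw [hre, hre']
      have hge := SimplexSlicing.integral_laplaceProd_ge hsq hlt
      have hπ := Real.pi_pos
      calc 1 / Real.exp 1 = (2 * Real.pi)⁻¹ * (2 * Real.pi / Real.exp 1) := by field_simp
        _ ≤ _ := mul_le_mul_of_nonneg_left hge (by positivity)
    · rintro ⟨k, rfl | rfl⟩
      · simpa using hlt k
      · simpa using hlt k
  -- A coordinate of modulus `1` forces all others to vanish. The characteristic function is then
  -- not integrable, but the density is explicit and jumps only at `-u k ≠ 0`.
  · push Not at hlt
    obtain ⟨k, hk⟩ := hlt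
    have hk1 : |u k| = 1 := le_antisymm (abs_le_one_iff_mul_self_le_one.2 (by nlinarith [hle k])) hk
    have hk0 : u k ≠ 0 := fun h => by simp [h] at hk1
    have hzero : ∀ j, j ≠ k → u j = 0 := by
      intro j hj
      have h1 := Finset.add_sum_erase Finset.univ (fun j => u j ^ 2) (Finset.mem_univ k)
      have h2 : u j ^ 2 ≤ ∑ j ∈ Finset.univ.erase k, u j ^ 2 :=
        Finset.single_le_sum (f := fun j => u j ^ 2) (fun i _ => sq_nonneg _)
          (Finset.mem_erase.2 ⟨hj, Finset.mem_univ j⟩)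
      rw [hsq] at h1
      have h3 : u k ^ 2 = 1 := by rw [← sq_abs, hk1, one_pow]
      simp only [h3] at h1
      have : u j ^ 2 ≤ 0 := by linarith
      exact pow_eq_zero_iff two_ne_zero |>.1 (le_antisymm this (sq_nonneg _))
    have hsum : centeredSum u Y = fun ω => u k * (Y k ω - 1) := by
      ext ω
      rw [centeredSum, Finset.sum_eq_single k (fun j _ hj => by rw [hzero j hj, zero_mul]) (by simp)]
    have hdens : IsDensityOf μ (centeredSum u Y) (SimplexSlicing.scaledExpDensity (u k)) := by
      refine ⟨SimplexSlicing.measurable_scaledExpDensity _, SimplexSlicing.scaledExpDensity_nonneg _, ?_⟩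
      rw [hsum, SimplexSlicing.map_mul_sub_one_eq hlaw, SimplexSlicing.map_expMeasure_eq hk0]
    have hcont := SimplexSlicing.continuousAt_scaledExpDensity hk0 (neg_ne_zero.2 hk0).symm
    have hval : SimplexSlicing.scaledExpDensity (u k) 0 = 1 / Real.exp 1 := by
      simp [SimplexSlicing.scaledExpDensity, hk1, Real.exp_neg]
    refine ⟨⟨_, hdens, hcont⟩, fun g hg hgc => ?_⟩
    have heq : g 0 = 1 / Real.exp 1 :=
      (SimplexSlicing.IsDensityOf.unique_of_continuousAt hg hdens hgc hcont).trans hval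
    exact ⟨heq.ge, fun _ => heq⟩
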